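/- **Theorem 1 (Convergence of TDRC).** Consider a Markov decision process with states $\mathcal S$, a finite or countable action set $\mathcal A$, a transition law $P(\cdot\mid s,a)$ for the reward and the next state, a target policy $\pi$, a behaviour policy $b$, a distribution $d$ on $\mathcal S$ (e.g. the stationary distribution of $b$), a discount $\gamma\in[0,1]$ and features $\mathbf x:\mathcal S\to\mathbb R^n$. A transition is generated by $S\sim d$, $A\sim b(\cdot|S)$, $(R,S')\sim P(\cdot|S,A)$, and yields the sample $(\mathbf x(S),R,\mathbf x(S'),\rho)$ with $\rho=\pi(A|S)/b(A|S)$; $\mathbb E_b$ is expectation under this law and $\mathbb E_\pi$ the expectation when instead $A\sim\pi(\cdot|S)$. Let $$\mathbf C=\mathbb E_d[\mathbf x\mathbf x^\top],\quad \mathbf A=\mathbb E_\pi[\mathbf x(\mathbf x-\gamma\mathbf x')^\top],\quad \mathbf H=\tfrac12(\mathbf A+\mathbf A^\top).$$ A TD fixed point is a $\mathbf w$ with $\mathbb E_\pi[(R+\gamma\mathbf w^\top\mathbf x'-\mathbf w^\top\mathbf x)\,\mathbf x]=\mathbf 0$. Let $(\mathbf x_t,R_{t+1},\mathbf x_{t+1},\rho_t)_{t\ge0}$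 be i.i.d. samples with the above law (the third entry, written $\mathbf x_{t+1}$, is the feature vector $\mathbf x(S')$ of the next state within sample $t$). For $\eta>0$, $\beta\ge0$ and arbitrary $\mathbf h_0,\mathbf w_0\in\mathbb R^n$ let, with $\delta_t=R_{t+1}+\gamma\mathbf w_t^\top\mathbf x_{t+1}-\mathbf w_t^\top\mathbf x_t$, $$\mathbf h_{t+1}=\mathbf h_t+\eta\alpha_t[\rho_t\delta_t-\mathbf h_t^\top\mathbf x_t]\mathbf x_t-\eta\alpha_t\beta\mathbf h_t,\qquad \mathbf w_{t+1}=\mathbf w_t+\alpha_t\rho_t\delta_t\mathbf x_t-\alpha_t\rho_t\gamma(\mathbf h_t^\top\mathbf x_t)\mathbf x_{t+1},$$ with $\alpha_t\in(0,1]$, $\sum_t\alpha_t=\infty$, $\sum_t\alpha_t^2<\infty$. Assume coverage ($b(a|s)>0$ whenever $\pi(a|s)>0$), that $\mathbf C$ and $\mathbf A+\beta\mathbf I$ are non-singular, and finite second moments: either $\mathcal S,\mathcal A$ are finite and $\mathbb E_b[R^2]<\infty$, or, on general spaces, all entries of $\mathbf x\mathbf x^\top$, $\rho\,\mathbf x\mathbf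 x^\top$, $\rho\,\mathbf x\mathbf x'^\top$ and $\rho R\mathbf x$ have finite second moments under $\mathbb E_b$ (which holds automatically in the former case). Then there is exactly one TD fixed point and $\mathbf w_t$ converges to it almost surely, if one of the following holds: (i) $\mathbf A$ is positive definite, i.e. $\mathbf z^\top\mathbf A\mathbf z>0$ for all $\mathbf z\neq\mathbf 0$; or (ii) $\mathbf H$ is non-singular, $\beta<-\lambda_{\max}(\mathbf H^{-1}\mathbf A\mathbf A^\top)$ and $\eta>-\lambda_{\min}(\mathbf C^{-1}\mathbf H)$; or (ii') $\mathbf H$ and $\mathbf A$ are non-singular, $\mathbf A$ is not positive definite, $\beta<-\lambda^-_{\max}(\mathbf H^{-1}\mathbf A\mathbf A^\top)$ and $\eta>-\lambda_{\min}(\mathbf C^{-1}\mathbf H)$. Here $\lambda_{\max},\lambda_{\min}$ are the largest and smallest eigenvalues and $\lambda^-_{\max}$ is the largest negative eigenvalue. Moreover, if $\mathbf H$ is non-singular and $\mathbf A$ is not positive definite, all eigenvalues of $\mathbf H^{-1}\mathbf A\mathbf A^\top$ and $\mathbf C^{-1}\mathbf H$ are real; $-\lambda_{\min}(\mathbf C^{-1}\mathbf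 H)>0$; $-\lambda^-_{\max}(\mathbf H^{-1}\mathbf A\mathbf A^\top)>0$ (in particular a negative eigenvalue exists) if $\mathbf A$ is non-singular; and $-\lambda_{\max}(\mathbf H^{-1}\mathbf A\mathbf A^\top)>0$ if $-\mathbf A$ is positive definite. -/

import Mathlib

open MeasureTheory ProbabilityTheory Filter Topology
open scoped Matrix

/-- A policy-evaluation problem with linear function approximation: a Markov decision process with
states `S`, actions `A`, a joint law `P (s, a)` of the reward and the next state, a target policy
`π`, a behaviour policy `b`, a distribution `d` of the states at which samples are drawn (for
example the stationary distribution of `b`; stationarity is not required), a discount `γ` and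
`n`-dimensional features `x`. -/
structure OffPolicyProblem (S A : Type*) [MeasurableSpace S] [MeasurableSpace A] (n : ℕ) where
  P : Kernel (S × A) (ℝ × S)
  markovP : IsMarkovKernel P
  π : Kernel S A
  markovπ : IsMarkovKernel π
  b : Kernel S A
  markovb : IsMarkovKernel b
  d : Measure S
  probd : IsProbabilityMeasure d
  γ : ℝ
  γ_nonneg : 0 ≤ γ
  γ_le_one : γ ≤ 1
  x : S → Fin n → ℝ
  measurable_x : Measurable x

/-- A sample `(x_t, R_{t+1}, x_{t+1}, ρ_t)`. -/
abbrev Sample (n : ℕ) : Type := (Fin n → ℝ) × ℝ × (Fin n → ℝ) × ℝ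

namespace OffPolicyProblem

variable {S A : Type*} [MeasurableSpace S] [MeasurableSpace A] {n : ℕ}

attribute [instance] markovP markovπ markovb probd

/-- The law of a transition `((s, a), (r, s'))` when `s` is drawn from `d`, then `a` from the
policy `κ`, then `(r, s')` from `P`. -/
noncomputable def transitionLaw (M : OffPolicyProblem S A n) (κ : Kernel S A) :
    Measure ((S × A) × (ℝ × S)) :=
  (M.d ⊗ₘ κ) ⊗ₘ M.P

/-- The importance sampling ratio `π(a|s) / b(a|s)`. -/
noncomputable def ratio (M : OffPolicyProblem S A n) (p : S × A) : ℝ :=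
  (M.π p.1).real {p.2} / (M.b p.1).real {p.2}

/-- The sample `(x(s), r, x(s'), ρ(s, a))` seen by the agent on a transition. -/
noncomputable def observe (M : OffPolicyProblem S A n) (q : (S × A) × (ℝ × S)) : Sample n :=
  (M.x q.1.1, q.2.1, M.x q.2.2, M.ratio q.1)

/-- The law of a sample generated by the behaviour policy. -/
noncomputable def sampleLaw (M : OffPolicyProblem S A n) : Measure (Sample n) :=
  (M.transitionLaw M.b).map M.observe

/-- Coverage: every action that the target policy may take, the behaviour policy may take. -/
def Coverage (M : OffPolicyProblem S A n) : Prop :=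
  ∀ s a, 0 < M.π s {a} → 0 < M.b s {a}

/-- `C = E[x xᵀ]`. -/
noncomputable def C (M : OffPolicyProblem S A n) : Matrix (Fin n) (Fin n) ℝ :=
  Matrix.of fun i j => ∫ s, M.x s i * M.x s j ∂M.d

/-- `A = E_π[x (x - γ x')ᵀ]`. -/
noncomputable def Amat (M : OffPolicyProblem S A n) : Matrix (Fin n) (Fin n) ℝ :=
  Matrix.of fun i j =>
    ∫ q, M.x q.1.1 i * (M.x q.1.1 j - M.γ * M.x q.2.2 j) ∂(M.transitionLaw M.π)

/-- `H = (A + Aᵀ) / 2`. -/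
noncomputable def H (M : OffPolicyProblem S A n) : Matrix (Fin n) (Fin n) ℝ :=
  (1 / 2 : ℝ) • (M.Amat + M.Amatᵀ)

/-- `w` is a TD fixed point: `E_π[δ x] = 0` for the TD error `δ = R + γ wᵀx' - wᵀx`. -/
def IsTDFixedPoint (M : OffPolicyProblem S A n) (w : Fin n → ℝ) : Prop :=
  ∀ i, ∫ q, (q.2.1 + M.γ * (w ⬝ᵥ M.x q.2.2) - w ⬝ᵥ M.x q.1.1) * M.x q.1.1 i
    ∂(M.transitionLaw M.π) = 0

/-- Finite second moments, in one of two forms: finitely many states and actions and rewards with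
a finite second moment; or, on arbitrary spaces, finite second moments of the products of features,
rewards and ratios that enter one update (automatic in the first form under coverage). -/
def FiniteSecondMoments (M : OffPolicyProblem S A n) : Prop :=
  (Finite S ∧ Finite A ∧ MemLp (fun q => q.2.1) 2 (M.transitionLaw M.b)) ∨
  ∀ i : Fin n,
    MemLp (fun q => M.ratio q.1 * q.2.1 * M.x q.1.1 i) 2 (M.transitionLaw M.b) ∧
    ∀ j : Fin n,
      MemLp (fun q => M.x q.1.1 i * M.x q.1.1 j) 2 (M.transitionLaw M.b) ∧
      MemLp (fun q => M.ratio q.1 * M.x q.1.1 i * M.x q.1.1 j) 2 (M.transitionLaw M.b) ∧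
      MemLp (fun q => M.ratio q.1 * M.x q.1.1 i * M.x q.2.2 j) 2 (M.transitionLaw M.b)

end OffPolicyProblem

/-- One TDRC update of `(h, w)` on the sample `(x, R, x', ρ)`, with stepsize `α`. -/
def tdrcStep {n : ℕ} (γ η β α : ℝ) (hw : (Fin n → ℝ) × (Fin n → ℝ)) (z : Sample n) :
    (Fin n → ℝ) × (Fin n → ℝ) :=
  let h := hw.1
  let w := hw.2
  let x := z.1
  let R := z.2.1
  let x' := z.2.2.1
  let ρ := z.2.2.2
  let δ := R + γ * (w ⬝ᵥ x') - w ⬝ᵥ x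
  (h + (η * α * (ρ * δ - h ⬝ᵥ x)) • x - (η * α * β) • h,
   w + (α * ρ * δ) • x - (α * ρ * γ * (h ⬝ᵥ x)) • x')

/-- The TDRC iterates `(h_t, w_t)` along a sequence of samples. -/
def tdrc {n : ℕ} (γ η β : ℝ) (α : ℕ → ℝ) (h₀ w₀ : Fin n → ℝ) (z : ℕ → Sample n) :
    ℕ → (Fin n → ℝ) × (Fin n → ℝ)
  | 0 => (h₀, w₀)
  | t + 1 => tdrcStep γ η β (α t) (tdrc γ η β α h₀ w₀ z t) (z t)

/-- Positive definiteness of a real matrix that need not be symmetric. -/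
def PosDefForm {n : ℕ} (B : Matrix (Fin n) (Fin n) ℝ) : Prop :=
  ∀ v : Fin n → ℝ, v ≠ 0 → 0 < v ⬝ᵥ (B *ᵥ v)

/-- The largest real eigenvalue (the set is finite). -/
noncomputable def lambdaMax {n : ℕ} (B : Matrix (Fin n) (Fin n) ℝ) : ℝ :=
  sSup (spectrum ℝ B)

/-- The smallest real eigenvalue. -/
noncomputable def lambdaMin {n : ℕ} (B : Matrix (Fin n) (Fin n) ℝ) : ℝ :=
  sInf (spectrum ℝ B)

/-- The largest negative eigenvalue. -/
noncomputable def lambdaMaxNeg {n : ℕ} (B : Matrix (Fin n) (Fin n) ℝ) : ℝ :=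
  sSup (spectrum ℝ B ∩ Set.Iio 0)

/-- All complex eigenvalues of the real matrix `B` are real. -/
def RealSpectrum {n : ℕ} (B : Matrix (Fin n) (Fin n) ℝ) : Prop :=
  ∀ z ∈ spectrum ℂ (B.map (algebraMap ℝ ℂ)), z.im = 0

section LinearAlgebra

variable {m : Type*} [Fintype m]

lemma Matrix.mem_spectrum_iff_exists_mulVec_eq [DecidableEq m] {K : Type*} [Field K]
    {B : Matrix m m K} {z : K} :
    z ∈ spectrum K B ↔ ∃ v : m → K, v ≠ 0 ∧ B *ᵥ v = z • v := by
  rw [← Matrix.spectrum_toLin', ← Module.End.hasEigenvalue_iff_mem_spectrum]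
  constructor
  · intro h
    obtain ⟨v, hv⟩ := h.exists_hasEigenvector
    exact ⟨v, hv.2, by simpa using hv.apply_eq_smul⟩
  · rintro ⟨v, hv, h⟩
    exact Module.End.hasEigenvalue_of_hasEigenvector
      ⟨Module.End.mem_eigenspace_iff.2 (by simpa using h), hv⟩

/-- Eigenvalues of `P⁻¹ N` are the generalized eigenvalues of the pencil `(N, P)`. -/
lemma Matrix.mem_spectrum_inv_mul_iff [DecidableEq m] {K : Type*} [Field K] {P N : Matrix m m K}
    (hP : IsUnit P) {z : K} :
    z ∈ spectrum K (P⁻¹ * N) ↔ ∃ v : m → K, v ≠ 0 ∧ N *ᵥ v = z • (P *ᵥ v) := by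
  have hdet := (Matrix.isUnit_iff_isUnit_det P).1 hP
  rw [Matrix.mem_spectrum_iff_exists_mulVec_eq]
  refine exists_congr fun v => and_congr_right fun _ => ⟨fun h => ?_, fun h => ?_⟩
  · have := congrArg (P *ᵥ ·) h
    simpa [Matrix.mulVec_mulVec, ← Matrix.mul_assoc, Matrix.mul_nonsing_inv _ hdet,
      Matrix.mulVec_smul] using this
  · rw [← Matrix.mulVec_mulVec, h, Matrix.mulVec_smul, Matrix.mulVec_mulVec,
      Matrix.nonsing_inv_mul _ hdet, Matrix.one_mulVec]

lemma Matrix.dotProduct_mulVec_comm_of_isSymm {N : Matrix m m ℝ} (hN : Nᵀ = N) (u v : m → ℝ) :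
    u ⬝ᵥ (N *ᵥ v) = v ⬝ᵥ (N *ᵥ u) := by
  rw [Matrix.dotProduct_mulVec, ← Matrix.mulVec_transpose, hN, dotProduct_comm]

lemma dotProduct_self_pos_of_ne_zero {v : m → ℝ} (hv : v ≠ 0) : 0 < v ⬝ᵥ v := by
  simpa using Matrix.dotProduct_star_self_pos_iff.2 hv

variable {n : ℕ}

lemma PosDefForm.isUnit {B : Matrix (Fin n) (Fin n) ℝ} (hB : PosDefForm B) : IsUnit B := by
  rw [Matrix.isUnit_iff_isUnit_det, isUnit_iff_ne_zero]
  intro h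
  obtain ⟨v, hv, hv0⟩ := Matrix.exists_mulVec_eq_zero_iff.2 h
  have := hB v hv
  simp [hv0] at this

lemma PosDefForm.posDef {B : Matrix (Fin n) (Fin n) ℝ} (hB : PosDefForm B) (hs : Bᵀ = B) :
    B.PosDef :=
  Matrix.PosDef.of_dotProduct_mulVec_pos (by simpa [Matrix.IsHermitian] using hs)
    fun v hv => by simpa using hB v hv

lemma Matrix.PosDef.posDefForm {B : Matrix (Fin n) (Fin n) ℝ} (hB : B.PosDef) : PosDefForm B :=
  fun v hv => by simpa using hB.dotProduct_mulVec_pos hv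

/-- If `P` is positive definite and the symmetric matrix `N` is not, then `P⁻¹ N` has an
eigenvalue `≤ 0`. -/
lemma PosDefForm.exists_nonpos_mem_spectrum {P N : Matrix (Fin n) (Fin n) ℝ} (hP : PosDefForm P)
    (hPs : Pᵀ = P) (hNs : Nᵀ = N) (hN : ¬ PosDefForm N) :
    ∃ z ∈ spectrum ℝ (P⁻¹ * N), z ≤ 0 := by
  obtain ⟨B, hB, rfl⟩ : ∃ B : Matrix (Fin n) (Fin n) ℝ, IsUnit B ∧ P = Bᵀ * B := by
    open scoped MatrixOrder Matrix.Norms.L2Operator in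
    obtain ⟨B, hB, h⟩ := CStarAlgebra.isStrictlyPositive_iff_eq_star_mul_self.mp
      (Matrix.isStrictlyPositive_iff_posDef.2 (hP.posDef hPs))
    exact ⟨B, hB, by simpa [Matrix.star_eq_conjTranspose] using h⟩
  have hdet := (Matrix.isUnit_iff_isUnit_det B).1 hB
  have hdetT : IsUnit (Bᵀ).det := by simpa using hdet
  set T := (B⁻¹)ᵀ * N * B⁻¹ with hT
  have hTH : T.IsHermitian := by
    simp [Matrix.IsHermitian, hT, Matrix.transpose_mul, hNs, Matrix.mul_assoc]
  have hTN : N = Bᵀ * T * B := by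
    rw [hT, Matrix.transpose_nonsing_inv]
    simp only [Matrix.mul_assoc, Matrix.nonsing_inv_mul _ hdet, Matrix.mul_one]
    rw [← Matrix.mul_assoc, Matrix.mul_nonsing_inv _ hdetT, Matrix.one_mul]
  have hTnot : ¬ T.PosDef := by
    intro hTp
    apply hN
    intro v hv
    have hBv : B *ᵥ v ≠ 0 := by
      intro h0
      apply hv
      have := congrArg (B⁻¹ *ᵥ ·) h0
      simpa [Matrix.mulVec_mulVec, Matrix.nonsing_inv_mul _ hdet] using this
    have := hTp.posDefForm _ hBv
    rw [hTN, Matrix.mul_assoc, ← Matrix.mulVec_mulVec, Matrix.dotProduct_mulVec,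
      Matrix.vecMul_transpose, ← Matrix.mulVec_mulVec]
    exact this
  rw [hTH.posDef_iff_eigenvalues_pos] at hTnot
  push Not at hTnot
  obtain ⟨i, hi⟩ := hTnot
  refine ⟨hTH.eigenvalues i, (Matrix.mem_spectrum_inv_mul_iff hP.isUnit).2
    ⟨B⁻¹ *ᵥ (hTH.eigenvectorBasis i).ofLp, ?_, ?_⟩, hi⟩
  · intro h0
    have := congrArg (B *ᵥ ·) h0
    simp only [Matrix.mulVec_mulVec, Matrix.mul_nonsing_inv _ hdet, Matrix.one_mulVec,
      Matrix.mulVec_zero] at this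
    have h1 : hTH.eigenvectorBasis i = 0 := by
      ext j; simpa using congrFun this j
    exact hTH.eigenvectorBasis.orthonormal.ne_zero i h1
  · have := hTH.mulVec_eigenvectorBasis i
    rw [hTN, Matrix.mulVec_mulVec, Matrix.mulVec_mulVec, Matrix.mul_assoc, Matrix.mul_assoc,
      Matrix.mul_nonsing_inv _ hdet, Matrix.mul_one, Matrix.mul_assoc,
      Matrix.mul_nonsing_inv _ hdet, Matrix.mul_one, ← Matrix.mulVec_mulVec,
      this, Matrix.mulVec_smul]

/-- The Hermitian form of a real matrix at a complex vector. -/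
lemma Matrix.star_dotProduct_map_mulVec (B : Matrix m m ℝ) (v : m → ℂ) :
    star v ⬝ᵥ (B.map (algebraMap ℝ ℂ) *ᵥ v) =
      ⟨(fun i => (v i).re) ⬝ᵥ (B *ᵥ fun i => (v i).re) +
        (fun i => (v i).im) ⬝ᵥ (B *ᵥ fun i => (v i).im),
       (fun i => (v i).re) ⬝ᵥ (B *ᵥ fun i => (v i).im) -
        (fun i => (v i).im) ⬝ᵥ (B *ᵥ fun i => (v i).re)⟩ := by
  apply Complex.ext
  · simp [dotProduct, Matrix.mulVec, Complex.re_sum, Finset.mul_sum, ← Finset.sum_add_distrib]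
  · simp [dotProduct, Matrix.mulVec, Complex.im_sum, Finset.mul_sum, ← Finset.sum_sub_distrib]
    refine Finset.sum_congr rfl fun i _ => Finset.sum_congr rfl fun j _ => by ring

lemma Matrix.im_star_dotProduct_map_mulVec {B : Matrix m m ℝ} (hB : Bᵀ = B) (v : m → ℂ) :
    (star v ⬝ᵥ (B.map (algebraMap ℝ ℂ) *ᵥ v)).im = 0 := by
  rw [Matrix.star_dotProduct_map_mulVec]
  exact sub_eq_zero.2 (Matrix.dotProduct_mulVec_comm_of_isSymm hB _ _)

lemma Complex.re_ne_zero_or_im_ne_zero {v : m → ℂ} (hv : v ≠ 0) :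
    (fun i => (v i).re) ≠ 0 ∨ (fun i => (v i).im) ≠ 0 := by
  by_contra! h
  exact hv (funext fun i => Complex.ext (congrFun h.1 i) (congrFun h.2 i))

lemma PosDefForm.re_star_dotProduct_pos {B : Matrix (Fin n) (Fin n) ℝ} (hB : PosDefForm B)
    {v : Fin n → ℂ} (hv : v ≠ 0) :
    0 < (star v ⬝ᵥ (B.map (algebraMap ℝ ℂ) *ᵥ v)).re := by
  have h : ∀ u : Fin n → ℝ, 0 ≤ u ⬝ᵥ (B *ᵥ u) := fun u => by
    by_cases hu : u = 0
    · simp [hu]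
    · exact (hB u hu).le
  rw [Matrix.star_dotProduct_map_mulVec]
  rcases Complex.re_ne_zero_or_im_ne_zero hv with h1 | h1
  · exact add_pos_of_pos_of_nonneg (hB _ h1) (h _)
  · exact add_pos_of_nonneg_of_pos (h _) (hB _ h1)

lemma Matrix.map_mulVec_eq_of_mem_spectrum_inv_mul [DecidableEq m] {P N : Matrix m m ℝ}
    (hP : IsUnit P) {z : ℂ}
    (hz : z ∈ spectrum ℂ ((P⁻¹ * N).map (algebraMap ℝ ℂ))) :
    ∃ v : m → ℂ, v ≠ 0 ∧
      N.map (algebraMap ℝ ℂ) *ᵥ v = z • (P.map (algebraMap ℝ ℂ) *ᵥ v) := by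
  obtain ⟨v, hv, h⟩ := Matrix.mem_spectrum_iff_exists_mulVec_eq.1 hz
  refine ⟨v, hv, ?_⟩
  have hdet := (Matrix.isUnit_iff_isUnit_det P).1 hP
  rw [← Matrix.mulVec_smul, ← h, Matrix.mulVec_mulVec, ← Matrix.map_mul, ← Matrix.mul_assoc,
    Matrix.mul_nonsing_inv _ hdet, Matrix.one_mul]

lemma realSpectrum_inv_mul_of_posDefForm {P N : Matrix (Fin n) (Fin n) ℝ} (hP : PosDefForm P)
    (hPs : Pᵀ = P) (hNs : Nᵀ = N) : RealSpectrum (P⁻¹ * N) := by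
  intro z hz
  obtain ⟨v, hv, h⟩ := Matrix.map_mulVec_eq_of_mem_spectrum_inv_mul hP.isUnit hz
  have h1 := congrArg (fun u => (star v ⬝ᵥ u).im) h
  simp only [dotProduct_smul, smul_eq_mul, Complex.mul_im,
    Matrix.im_star_dotProduct_map_mulVec hPs, Matrix.im_star_dotProduct_map_mulVec hNs] at h1
  have := hP.re_star_dotProduct_pos hv
  rw [mul_zero, zero_add] at h1
  exact (mul_eq_zero.1 h1.symm).resolve_right this.ne'

lemma realSpectrum_inv_mul_mul_transpose {N B : Matrix (Fin n) (Fin n) ℝ} (hN : IsUnit N)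
    (hNs : Nᵀ = N) : RealSpectrum (N⁻¹ * (B * Bᵀ)) := by
  intro z hz
  obtain ⟨v, hv, h⟩ := Matrix.map_mulVec_eq_of_mem_spectrum_inv_mul hN hz
  have h0 := congrArg (fun u => star v ⬝ᵥ u) h
  simp only [dotProduct_smul, smul_eq_mul] at h0
  have hr := Matrix.im_star_dotProduct_map_mulVec hNs v
  have hK := Matrix.im_star_dotProduct_map_mulVec (B := B * Bᵀ) (by simp) v
  by_cases h1 : (star v ⬝ᵥ ((B * Bᵀ).map (algebraMap ℝ ℂ) *ᵥ v)) = 0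
  · have h2 : (B * Bᵀ).map (algebraMap ℝ ℂ) *ᵥ v = 0 := by
      open scoped ComplexOrder in
      have hpsd : ((B * Bᵀ).map (algebraMap ℝ ℂ)).PosSemidef := by
        have := Matrix.posSemidef_self_mul_conjTranspose (B.map (algebraMap ℝ ℂ))
        convert this using 1
        rw [Matrix.map_mul]
        congr 1
        ext i j
        simp
      exact (hpsd.dotProduct_mulVec_zero_iff v).1 h1
    by_contra hzi
    have hz0 : z ≠ 0 := fun h => hzi (by simp [h])
    rw [h2] at h
    have h3 : N.map (algebraMap ℝ ℂ) *ᵥ v = 0 := (smul_eq_zero.1 h.symm).resolve_left hz0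
    have hdet := (Matrix.isUnit_iff_isUnit_det N).1 hN
    have := congrArg ((N⁻¹).map (algebraMap ℝ ℂ) *ᵥ ·) h3
    simp only [Matrix.mulVec_mulVec, ← Matrix.map_mul, Matrix.nonsing_inv_mul _ hdet,
      Matrix.mulVec_zero] at this
    exact hv (by simpa using this)
  · have h2 := congrArg Complex.im h0
    rw [hK, Complex.mul_im, hr] at h2
    have h3 : (star v ⬝ᵥ (N.map (algebraMap ℝ ℂ) *ᵥ v)).re ≠ 0 := by
      intro h4
      exact h1 (by rw [h0, Complex.ext (z := star v ⬝ᵥ _) (w := 0) h4 hr, mul_zero])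
    rw [mul_zero, zero_add] at h2
    exact (mul_eq_zero.1 h2.symm).resolve_right h3

lemma posDefForm_mul_transpose {B : Matrix (Fin n) (Fin n) ℝ} (hB : IsUnit B) :
    PosDefForm (B * Bᵀ) := by
  intro v hv
  rw [← Matrix.mulVec_mulVec, Matrix.dotProduct_mulVec, ← Matrix.mulVec_transpose]
  refine dotProduct_self_pos_of_ne_zero fun h => ?_
  have hdet : (Bᵀ).det ≠ 0 := by
    simpa using ((Matrix.isUnit_iff_isUnit_det B).1 hB).ne_zero
  exact hdet (Matrix.exists_mulVec_eq_zero_iff.1 ⟨v, hv, h⟩)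

lemma PosDefForm.congr_form {B B' : Matrix (Fin n) (Fin n) ℝ}
    (h : ∀ v, v ⬝ᵥ (B' *ᵥ v) = v ⬝ᵥ (B *ᵥ v)) : PosDefForm B' ↔ PosDefForm B := by
  simp only [PosDefForm, h]

lemma dotProduct_half_add_transpose_mulVec (B : Matrix m m ℝ) (v : m → ℝ) :
    v ⬝ᵥ (((1 / 2 : ℝ) • (B + Bᵀ)) *ᵥ v) = v ⬝ᵥ (B *ᵥ v) := by
  have : v ⬝ᵥ (Bᵀ *ᵥ v) = v ⬝ᵥ (B *ᵥ v) := by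
    rw [Matrix.mulVec_transpose, dotProduct_comm, ← Matrix.dotProduct_mulVec]
  rw [Matrix.smul_mulVec, Matrix.add_mulVec, dotProduct_smul, dotProduct_add, this, smul_eq_mul]
  ring

section Pencils

variable {C N K : Matrix (Fin n) (Fin n) ℝ}

lemma exists_neg_mem_spectrum_inv_mul (hC : PosDefForm C) (hCs : Cᵀ = C) (hN : IsUnit N)
    (hNs : Nᵀ = N) (hnot : ¬ PosDefForm N) : ∃ z ∈ spectrum ℝ (C⁻¹ * N), z < 0 := by
  obtain ⟨z, hz, hz0⟩ := hC.exists_nonpos_mem_spectrum hCs hNs hnot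
  refine ⟨z, hz, lt_of_le_of_ne hz0 ?_⟩
  rintro rfl
  obtain ⟨v, hv, h⟩ := (Matrix.mem_spectrum_inv_mul_iff hC.isUnit).1 hz
  rw [zero_smul] at h
  exact ((Matrix.isUnit_iff_isUnit_det N).1 hN).ne_zero (Matrix.exists_mulVec_eq_zero_iff.1 ⟨v, hv, h⟩)

lemma lambdaMin_inv_mul_neg (hC : PosDefForm C) (hCs : Cᵀ = C) (hN : IsUnit N)
    (hNs : Nᵀ = N) (hnot : ¬ PosDefForm N) : lambdaMin (C⁻¹ * N) < 0 := by
  obtain ⟨z, hz, hz0⟩ := exists_neg_mem_spectrum_inv_mul hC hCs hN hNs hnot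
  exact (csInf_le (Matrix.finite_spectrum _).bddBelow hz).trans_lt hz0

lemma inv_mem_spectrum_inv_mul (hK : IsUnit K) (hN : IsUnit N) {z : ℝ} (hz : z ≠ 0)
    (h : z ∈ spectrum ℝ (K⁻¹ * N)) : z⁻¹ ∈ spectrum ℝ (N⁻¹ * K) := by
  obtain ⟨v, hv, h⟩ := (Matrix.mem_spectrum_inv_mul_iff hK).1 h
  exact (Matrix.mem_spectrum_inv_mul_iff hN).2 ⟨v, hv, by rw [h, inv_smul_smul₀ hz]⟩

lemma exists_neg_mem_spectrum_inv_mul_posDef (hK : PosDefForm K) (hKs : Kᵀ = K) (hN : IsUnit N)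
    (hNs : Nᵀ = N) (hnot : ¬ PosDefForm N) : ∃ z ∈ spectrum ℝ (N⁻¹ * K), z < 0 := by
  obtain ⟨z, hz, hz0⟩ := exists_neg_mem_spectrum_inv_mul hK hKs hN hNs hnot
  exact ⟨z⁻¹, inv_mem_spectrum_inv_mul hK.isUnit hN hz0.ne hz, inv_lt_zero.2 hz0⟩

lemma lambdaMaxNeg_inv_mul_neg (hK : PosDefForm K) (hKs : Kᵀ = K) (hN : IsUnit N)
    (hNs : Nᵀ = N) (hnot : ¬ PosDefForm N) : lambdaMaxNeg (N⁻¹ * K) < 0 := by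
  obtain ⟨z, hz, hz0⟩ := exists_neg_mem_spectrum_inv_mul_posDef hK hKs hN hNs hnot
  have hfin : (spectrum ℝ (N⁻¹ * K) ∩ Set.Iio 0).Finite := (Matrix.finite_spectrum _).inter_of_left _
  have hne : (spectrum ℝ (N⁻¹ * K) ∩ Set.Iio 0).Nonempty := ⟨z, hz, hz0⟩
  exact (hne.csSup_mem hfin).2

lemma lambdaMax_inv_mul_neg (hK : PosDefForm K) (hKs : Kᵀ = K) (hN : IsUnit N)
    (hNs : Nᵀ = N) (hnot : ¬ PosDefForm N) (hneg : PosDefForm (-N)) :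
    lambdaMax (N⁻¹ * K) < 0 := by
  obtain ⟨z, hz, -⟩ := exists_neg_mem_spectrum_inv_mul_posDef hK hKs hN hNs hnot
  have hmem := Set.Nonempty.csSup_mem ⟨z, hz⟩ (Matrix.finite_spectrum (N⁻¹ * K))
  obtain ⟨v, hv, h⟩ := (Matrix.mem_spectrum_inv_mul_iff hN).1 hmem
  have h1 := congrArg (v ⬝ᵥ ·) h
  simp only [dotProduct_smul, smul_eq_mul] at h1
  have h2 := hK v hv
  have h3 := hneg v hv
  rw [Matrix.neg_mulVec, dotProduct_neg] at h3
  rw [h1] at h2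
  by_contra! h4
  change 0 ≤ sSup (spectrum ℝ (N⁻¹ * K)) at h4
  nlinarith

/-- `η C + N` is positive definite once `η` exceeds `-λ_min (C⁻¹ N)`. -/
lemma posDefForm_smul_add {η : ℝ} (hC : PosDefForm C) (hCs : Cᵀ = C) (hNs : Nᵀ = N)
    (h : ∀ z ∈ spectrum ℝ (C⁻¹ * N), -η < z) : PosDefForm (η • C + N) := by
  by_contra hnot
  obtain ⟨z, hz, hz0⟩ := hC.exists_nonpos_mem_spectrum hCs (by simp [hCs, hNs]) hnot
  obtain ⟨v, hv, hv'⟩ := (Matrix.mem_spectrum_inv_mul_iff hC.isUnit).1 hz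
  have := h (z - η) ((Matrix.mem_spectrum_inv_mul_iff hC.isUnit).2 ⟨v, hv, by
    rw [sub_smul, ← hv', Matrix.add_mulVec, Matrix.smul_mulVec, add_sub_cancel_left]⟩)
  linarith

/-- `K + β N` is positive definite if every negative eigenvalue of `N⁻¹ K` is below `-β`. -/
lemma posDefForm_add_smul {β : ℝ} (hβ : 0 ≤ β) (hK : PosDefForm K) (hKs : Kᵀ = K) (hN : IsUnit N)
    (hNs : Nᵀ = N) (h : ∀ z ∈ spectrum ℝ (N⁻¹ * K), z < 0 → β < -z) :
    PosDefForm (K + β • N) := by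
  by_contra hnot
  obtain ⟨z, hz, hz0⟩ := hK.exists_nonpos_mem_spectrum hKs (by simp [hKs, hNs]) hnot
  obtain ⟨v, hv, hv'⟩ := (Matrix.mem_spectrum_inv_mul_iff hK.isUnit).1 hz
  have hβ0 : 0 < β := by
    rcases hβ.eq_or_lt with rfl | h'
    · have h1 := congrArg (v ⬝ᵥ ·) hv'
      simp only [zero_smul, add_zero, dotProduct_smul, smul_eq_mul] at h1
      have := hK v hv
      nlinarith
    · exact h'
  have hv2 : K *ᵥ v = (-β / (1 - z)) • (N *ᵥ v) := by
    have h1 : (1 - z) • (K *ᵥ v) = (-β) • (N *ᵥ v) := by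
      rw [sub_smul, ← hv', Matrix.add_mulVec, Matrix.smul_mulVec, one_smul, neg_smul]
      abel
    rw [div_eq_inv_mul, mul_smul, ← h1, inv_smul_smul₀ (by linarith)]
  have h3 := h _ ((Matrix.mem_spectrum_inv_mul_iff hN).2 ⟨v, hv, hv2⟩)
    (div_neg_of_neg_of_pos (by linarith) (by linarith))
  rw [neg_div, neg_neg, lt_div_iff₀ (by linarith)] at h3
  nlinarith

end Pencils

end LinearAlgebra

section Stability

lemma dotProduct_self_nonneg_real {m : Type*} [Fintype m] (v : m → ℝ) : 0 ≤ v ⬝ᵥ v :=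
  Finset.sum_nonneg fun i _ => mul_self_nonneg (v i)

variable {n : ℕ}

/-- Routh–Hurwitz for a complex quadratic. -/
lemma Complex.re_pos_of_quadratic {p q z : ℂ} (hz : z ^ 2 - p * z + q = 0) (hp : 0 < p.re)
    (h : 0 < p.re * (p.re * q.re + p.im * q.im) - q.im ^ 2) : 0 < z.re := by
  obtain ⟨w, rfl⟩ : ∃ w, p = z + w := ⟨p - z, by ring⟩
  obtain rfl : q = z * w := by linear_combination hz
  have key : 0 < (z.re * w.re) * ((z.re + w.re) ^ 2 + (z.im - w.im) ^ 2) := by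
    refine h.trans_eq ?_
    simp only [Complex.add_re, Complex.add_im, Complex.mul_re, Complex.mul_im]
    ring
  have h2 : 0 < z.re * w.re := pos_of_mul_pos_left key (by positivity)
  rw [Complex.add_re] at hp
  by_contra! h3
  nlinarith

/-- The mean matrix of the TDRC recursion has its spectrum in the open right half-plane. -/
lemma re_pos_of_mem_spectrum_tdrc {A C : Matrix (Fin n) (Fin n) ℝ} {η β : ℝ} (hη : 0 < η)
    (hβ : 0 ≤ β) (hCs : Cᵀ = C) (hC : PosDefForm C)
    (hK : PosDefForm (A * Aᵀ + β • ((1 / 2 : ℝ) • (A + Aᵀ))))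
    (hP : PosDefForm (η • C + (1 / 2 : ℝ) • (A + Aᵀ))) {z : ℂ}
    (hz : z ∈ spectrum ℂ ((Matrix.fromBlocks (η • (C + β • (1 : Matrix (Fin n) (Fin n) ℝ)))
      (η • A) (C - Aᵀ) A).map
      (algebraMap ℝ ℂ))) : 0 < z.re := by
  obtain ⟨v, hv, h⟩ := Matrix.mem_spectrum_iff_exists_mulVec_eq.1 hz
  obtain ⟨x, y, rfl⟩ : ∃ x y : Fin n → ℂ, v = Sum.elim x y :=
    ⟨v ∘ Sum.inl, v ∘ Sum.inr, (Sum.elim_comp_inl_inr v).symm⟩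
  set a := A.map (algebraMap ℝ ℂ) with ha
  set c := C.map (algebraMap ℝ ℂ) with hc
  have hat : (Aᵀ).map (algebraMap ℝ ℂ) = aᵀ := by rw [ha, Matrix.transpose_map]
  have hmap : (Matrix.fromBlocks (η • (C + β • (1 : Matrix (Fin n) (Fin n) ℝ))) (η • A)
      (C - Aᵀ) A).map (algebraMap ℝ ℂ) =
      Matrix.fromBlocks ((η : ℂ) • (c + (β : ℂ) • (1 : Matrix (Fin n) (Fin n) ℂ))) ((η : ℂ) • a)
        (c - aᵀ) a := by
    rw [Matrix.fromBlocks_map]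
    congr 1
    · ext i j
      by_cases hij : i = j <;> simp [hc, hij, mul_add]
    · ext i j
      simp [ha]
    · ext i j
      simp [hc, ha]
  rw [hmap, Matrix.fromBlocks_mulVec] at h
  have h1 : (η : ℂ) • (c *ᵥ x + (β : ℂ) • x + a *ᵥ y) = z • x := by
    have := congrArg (· ∘ Sum.inl) h
    simp only [Sum.elim_comp_inl, Sum.elim_comp_inr] at this
    rw [Matrix.smul_mulVec, Matrix.add_mulVec, Matrix.smul_mulVec, Matrix.smul_mulVec,
      Matrix.one_mulVec, ← smul_add] at this
    exact this
  have h2 : c *ᵥ x - aᵀ *ᵥ x + a *ᵥ y = z • y := by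
    have := congrArg (· ∘ Sum.inr) h
    simp only [Sum.elim_comp_inl, Sum.elim_comp_inr] at this
    rwa [Matrix.sub_mulVec] at this
  have h3 : (η : ℂ) • ((β : ℂ) • x + aᵀ *ᵥ x) = z • (x - (η : ℂ) • y) := by
    rw [smul_sub, ← h1, smul_comm z, ← h2, ← smul_sub]
    congr 1
    abel
  have h4 : z ^ 2 • x - z • ((η : ℂ) • (c *ᵥ x + (β : ℂ) • x) + a *ᵥ x) +
      (η : ℂ) • ((β : ℂ) • (a *ᵥ x) + a *ᵥ (aᵀ *ᵥ x)) = 0 := by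
    have h5 := congrArg (a *ᵥ ·) h3
    simp only [Matrix.mulVec_smul, Matrix.mulVec_add, Matrix.mulVec_sub] at h5
    rw [h5, pow_two, mul_smul, ← h1]
    module
  have hAdet : A.det ≠ 0 := by
    rw [← Matrix.det_transpose]
    intro h0
    obtain ⟨v, hv, hv0⟩ := Matrix.exists_mulVec_eq_zero_iff.2 h0
    have := hK v hv
    rw [Matrix.add_mulVec, Matrix.smul_mulVec, dotProduct_add, dotProduct_smul,
      dotProduct_half_add_transpose_mulVec, ← Matrix.mulVec_mulVec, hv0, Matrix.mulVec_zero,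
      dotProduct_zero, Matrix.dotProduct_mulVec, ← Matrix.mulVec_transpose, hv0] at this
    simp at this
  have hx : x ≠ 0 := by
    rintro rfl
    have hy : y ≠ 0 := by
      rintro rfl
      exact hv (by ext i; cases i <;> rfl)
    simp only [Matrix.mulVec_zero, smul_zero, add_zero, zero_sub, sub_self, zero_add,
      smul_neg] at h2 h3
    have hz0 : z = 0 := by
      have h5 := neg_eq_zero.1 h3.symm
      rw [smul_eq_zero, smul_eq_zero] at h5
      have : (η : ℂ) ≠ 0 := by exact_mod_cast hη.ne'
      tauto
    rw [hz0, zero_smul] at h2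
    have hdet : a.det ≠ 0 := by
      have : a.det = (A.det : ℂ) := ((algebraMap ℝ ℂ).map_det A).symm
      rw [this]
      exact_mod_cast hAdet
    exact hdet (Matrix.exists_mulVec_eq_zero_iff.1 ⟨y, hy, h2⟩)
  have hone : star x ⬝ᵥ x = star x ⬝ᵥ
      ((1 : Matrix (Fin n) (Fin n) ℝ).map (algebraMap ℝ ℂ) *ᵥ x) := by
    simp
  have h5 := congrArg (star x ⬝ᵥ ·) h4
  rw [← hat, Matrix.mulVec_mulVec, ha, ← Matrix.map_mul, ← ha] at h5
  simp only [dotProduct_add, dotProduct_sub, dotProduct_smul, smul_eq_mul, dotProduct_zero] at h5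
  have hone_pos := PosDefForm.re_star_dotProduct_pos (B := (1 : Matrix (Fin n) (Fin n) ℝ))
    (fun v hv => by simpa using dotProduct_self_pos_of_ne_zero hv) hx
  have hone_im := Matrix.im_star_dotProduct_map_mulVec (B := (1 : Matrix (Fin n) (Fin n) ℝ))
    (by simp) x
  have hC_im := Matrix.im_star_dotProduct_map_mulVec hCs x
  have hC_pos := hC.re_star_dotProduct_pos hx
  have hK_im := Matrix.im_star_dotProduct_map_mulVec (B := A * Aᵀ) (by simp) x
  have hK_pos : 0 < (star x ⬝ᵥ ((A * Aᵀ).map (algebraMap ℝ ℂ) *ᵥ x)).re +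
      β * (star x ⬝ᵥ (a *ᵥ x)).re := by
    have := hK.re_star_dotProduct_pos hx
    rw [Matrix.star_dotProduct_map_mulVec] at this ⊢
    rw [ha, Matrix.star_dotProduct_map_mulVec]
    simp only [Matrix.add_mulVec _ (β • _), Matrix.smul_mulVec β, dotProduct_add, dotProduct_smul,
      dotProduct_half_add_transpose_mulVec, smul_eq_mul] at this ⊢
    linarith
  have hP_pos : 0 < η * (star x ⬝ᵥ (c *ᵥ x)).re + (star x ⬝ᵥ (a *ᵥ x)).re := by
    have := hP.re_star_dotProduct_pos hx
    rw [Matrix.star_dotProduct_map_mulVec] at this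
    rw [ha, hc, Matrix.star_dotProduct_map_mulVec, Matrix.star_dotProduct_map_mulVec]
    simp only [Matrix.add_mulVec (η • C), Matrix.smul_mulVec η, dotProduct_add, dotProduct_smul,
      dotProduct_half_add_transpose_mulVec, smul_eq_mul] at this ⊢
    linarith
  rw [← hone] at hone_pos hone_im
  rw [← hc] at hC_im hC_pos
  generalize star x ⬝ᵥ x = s at *
  generalize star x ⬝ᵥ (c *ᵥ x) = cf at *
  generalize star x ⬝ᵥ (a *ᵥ x) = af at *
  generalize star x ⬝ᵥ ((A * Aᵀ).map (algebraMap ℝ ℂ) *ᵥ x) = kf at *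
  have hpos : 0 < (s * z).re := by
    refine Complex.re_pos_of_quadratic (p := η * (cf + β * s) + af)
      (q := s * (η * (β * af + kf))) ?_ ?_ ?_
    · linear_combination s * h5
    · simp only [Complex.add_re, Complex.re_ofReal_mul]
      have := mul_nonneg hη.le (mul_nonneg hβ hone_pos.le)
      linarith
    · have h6 : 0 < η * (cf.re + β * s.re) + af.re := by
        have := mul_nonneg hη.le (mul_nonneg hβ hone_pos.le)
        linarith
      have h7 : 0 < s.re * η * ((η * (cf.re + β * s.re) + af.re) ^ 2 * (kf.re + β * af.re) +
          β * af.im ^ 2 * (η * cf.re + af.re)) := by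
        have := mul_nonneg (mul_nonneg hβ (sq_nonneg af.im)) hP_pos.le
        positivity
      refine h7.trans_eq ?_
      simp only [Complex.add_re, Complex.add_im, Complex.ofReal_re, Complex.ofReal_im,
        Complex.mul_re, Complex.mul_im, hone_im, hC_im, hK_im]
      ring
  rw [Complex.mul_re, hone_im, zero_mul, sub_zero] at hpos
  exact pos_of_mul_pos_right hpos hone_pos.le

end Stability

section Lyapunov

variable {m : Type*} [Fintype m]

open scoped Matrix.Norms.Operator in
lemma Matrix.tendsto_pow_nhds_zero [DecidableEq m] {B : Matrix m m ℂ} (h : ∀ z ∈ spectrum ℂ B, ‖z‖ < 1) :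
    Tendsto (fun k : ℕ => B ^ k) atTop (𝓝 0) := by
  rcases isEmpty_or_nonempty m with hm | hm
  · exact tendsto_const_nhds.congr fun k => Subsingleton.elim _ _
  have hr : spectralRadius ℂ B < ((1 : NNReal) : ENNReal) :=
    spectrum.spectralRadius_lt_of_forall_lt_of_nonempty (spectrum.nonempty B) fun z hz => h z hz
  obtain ⟨r, hr1, hr2⟩ := ENNReal.lt_iff_exists_nnreal_btwn.1 hr
  rw [ENNReal.coe_lt_coe] at hr2
  have hev := (spectrum.pow_nnnorm_pow_one_div_tendsto_nhds_spectralRadius B).eventually_lt_const hr1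
  refine tendsto_zero_iff_norm_tendsto_zero.2 ?_
  refine squeeze_zero' (.of_forall fun k => norm_nonneg _) (g := fun k => (r : ℝ) ^ k) ?_
    (tendsto_pow_atTop_nhds_zero_of_lt_one r.2 hr2)
  filter_upwards [hev, eventually_gt_atTop 0] with k hk hk0
  have h2 : (‖B ^ k‖₊ : ENNReal) ≤ (r : ENNReal) ^ k := by
    have := ENNReal.rpow_le_rpow hk.le (Nat.cast_nonneg (α := ℝ) k)
    rwa [← ENNReal.rpow_mul, one_div_mul_cancel (by positivity), ENNReal.rpow_one,
      ENNReal.rpow_natCast] at this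
  exact_mod_cast h2

lemma Matrix.exists_norm_one_sub_smul_lt_one [DecidableEq m] {G : Matrix m m ℂ}
    (hG : ∀ z ∈ spectrum ℂ G, 0 < z.re) :
    ∃ ε : ℝ, 0 < ε ∧ ∀ z ∈ spectrum ℂ (1 - (ε : ℂ) • G), ‖z‖ < 1 := by
  have hev : ∀ᶠ ε : ℝ in 𝓝[>] 0, ∀ z ∈ spectrum ℂ G, ‖1 - (ε : ℂ) * z‖ < 1 := by
    rw [eventually_all_finite (Matrix.finite_spectrum G)]
    intro z hz
    have hlim : Tendsto (fun ε : ℝ => ε * ‖z‖ ^ 2) (𝓝[>] 0) (𝓝 (0 * ‖z‖ ^ 2)) :=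
      (tendsto_nhdsWithin_of_tendsto_nhds tendsto_id).mul_const _
    rw [zero_mul] at hlim
    filter_upwards [hlim.eventually_lt_const (hG z hz), self_mem_nhdsWithin] with ε h1 h2
    have h2 : 0 < ε := h2
    rw [← sq_lt_one_iff₀ (norm_nonneg _), ← Complex.normSq_eq_norm_sq]
    rw [← Complex.normSq_eq_norm_sq] at h1
    simp only [Complex.normSq_apply, Complex.sub_re, Complex.sub_im, Complex.one_re,
      Complex.one_im, Complex.re_ofReal_mul, Complex.im_ofReal_mul] at h1 ⊢
    have := hG z hz
    nlinarith [mul_pos h2 this]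
  obtain ⟨ε, hε, hε0⟩ := (hev.and self_mem_nhdsWithin).exists
  have hε0 : 0 < ε := hε0
  have hεC : (ε : ℂ) ≠ 0 := by exact_mod_cast hε0.ne'
  refine ⟨ε, hε0, fun z hz => ?_⟩
  obtain ⟨v, hv, h⟩ := Matrix.mem_spectrum_iff_exists_mulVec_eq.1 hz
  have hmem : (1 - z) / ε ∈ spectrum ℂ G := by
    refine Matrix.mem_spectrum_iff_exists_mulVec_eq.2 ⟨v, hv, ?_⟩
    rw [Matrix.sub_mulVec, Matrix.one_mulVec, Matrix.smul_mulVec] at h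
    rw [div_eq_inv_mul, mul_smul, sub_smul, one_smul, ← h, sub_sub_cancel, inv_smul_smul₀ hεC]
  have := hε _ hmem
  rwa [mul_div_cancel₀ _ hεC, sub_sub_cancel] at this

lemma Matrix.mulVec_dotProduct_self_le (B : Matrix m m ℝ) (v : m → ℝ) :
    (B *ᵥ v) ⬝ᵥ (B *ᵥ v) ≤ (∑ i, ∑ j, B i j ^ 2) * (v ⬝ᵥ v) := by
  simp only [dotProduct, Matrix.mulVec, ← pow_two]
  rw [Finset.sum_mul]
  exact Finset.sum_le_sum fun i _ => Finset.sum_mul_sq_le_sq_mul_sq _ _ _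

lemma Matrix.exists_pow_contraction [DecidableEq m] {B : Matrix m m ℝ}
    (h : ∀ z ∈ spectrum ℂ (B.map (algebraMap ℝ ℂ)), ‖z‖ < 1) :
    ∃ N > 0, ∀ v, (B ^ N *ᵥ v) ⬝ᵥ (B ^ N *ᵥ v) ≤ 1 / 2 * (v ⬝ᵥ v) := by
  have h1 := Matrix.tendsto_pow_nhds_zero h
  have h2 : ∀ i j, Tendsto (fun k => (B ^ k) i j) atTop (𝓝 0) := fun i j => by
    have h3 := (tendsto_pi_nhds.1 (tendsto_pi_nhds.1 h1 i)) j
    have h4 := (Complex.continuous_re.tendsto _).comp h3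
    refine h4.congr fun k => ?_
    have h5 : (B.map (algebraMap ℝ ℂ)) ^ k = (B ^ k).map (algebraMap ℝ ℂ) :=
      (map_pow (algebraMap ℝ ℂ).mapMatrix B k).symm
    rw [Function.comp_apply, h5]
    simp
  have h6 : Tendsto (fun k => ∑ i, ∑ j, (B ^ k) i j ^ 2) atTop (𝓝 0) := by
    have := tendsto_finsetSum Finset.univ fun i _ =>
      tendsto_finsetSum Finset.univ fun j _ => (h2 i j).pow 2
    simpa using this
  obtain ⟨N, hN, hN0⟩ := ((h6.eventually_lt_const (by norm_num : (0 : ℝ) < 1 / 2)).and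
    (eventually_gt_atTop 0)).exists
  refine ⟨N, hN0, fun v => (Matrix.mulVec_dotProduct_self_le _ _).trans ?_⟩
  exact mul_le_mul_of_nonneg_right hN.le (dotProduct_self_nonneg_real v)

/-- Lyapunov's theorem, by means of the discrete flow `1 - ε G`. -/
lemma Matrix.exists_lyapunov [DecidableEq m] {G : Matrix m m ℝ}
    (hG : ∀ z ∈ spectrum ℂ (G.map (algebraMap ℝ ℂ)), 0 < z.re) :
    ∃ Q : Matrix m m ℝ, Qᵀ = Q ∧ (∀ v, v ⬝ᵥ v ≤ v ⬝ᵥ (Q *ᵥ v)) ∧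
      ∃ c > 0, ∀ v, c * (v ⬝ᵥ v) ≤ v ⬝ᵥ (Q *ᵥ (G *ᵥ v)) := by
  obtain ⟨ε, hε, hspec⟩ := Matrix.exists_norm_one_sub_smul_lt_one hG
  set B : Matrix m m ℝ := 1 - ε • G with hB
  have hBmap : B.map (algebraMap ℝ ℂ) = 1 - (ε : ℂ) • G.map (algebraMap ℝ ℂ) := by
    ext i j
    by_cases hij : i = j <;> simp [hB, hij]
  obtain ⟨N, hN, hcontr⟩ := Matrix.exists_pow_contraction (B := B) (by rwa [hBmap])
  set Q : Matrix m m ℝ := ∑ k ∈ Finset.range N, (B ^ k)ᵀ * B ^ k with hQ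
  have hQs : Qᵀ = Q := by simp [hQ, Matrix.transpose_sum, Matrix.transpose_mul]
  have hform : ∀ v, v ⬝ᵥ (Q *ᵥ v) =
      ∑ k ∈ Finset.range N, (B ^ k *ᵥ v) ⬝ᵥ (B ^ k *ᵥ v) := fun v => by
    rw [hQ, Matrix.sum_mulVec, dotProduct_sum]
    refine Finset.sum_congr rfl fun k _ => ?_
    rw [← Matrix.mulVec_mulVec, Matrix.dotProduct_mulVec, Matrix.vecMul_transpose]
  have hlow : ∀ v, v ⬝ᵥ v ≤ v ⬝ᵥ (Q *ᵥ v) := fun v => by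
    rw [hform]
    have := Finset.single_le_sum (f := fun k => (B ^ k *ᵥ v) ⬝ᵥ (B ^ k *ᵥ v))
      (fun k _ => dotProduct_self_nonneg_real _) (Finset.mem_range.2 hN)
    simpa using this
  refine ⟨Q, hQs, hlow, 1 / (4 * ε), by positivity, fun v => ?_⟩
  have hdec : (B *ᵥ v) ⬝ᵥ (Q *ᵥ (B *ᵥ v)) ≤ v ⬝ᵥ (Q *ᵥ v) - 1 / 2 * (v ⬝ᵥ v) := by
    have h1 := Finset.sum_range_succ (fun k => (B ^ k *ᵥ v) ⬝ᵥ (B ^ k *ᵥ v)) N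
    have h2 := Finset.sum_range_succ' (fun k => (B ^ k *ᵥ v) ⬝ᵥ (B ^ k *ᵥ v)) N
    have h3 := hcontr v
    rw [hform, hform]
    simp only [Matrix.mulVec_mulVec, ← pow_succ]
    simp only [pow_zero, Matrix.one_mulVec] at h2
    linarith
  have hexp : (B *ᵥ v) ⬝ᵥ (Q *ᵥ (B *ᵥ v)) = v ⬝ᵥ (Q *ᵥ v) - 2 * ε * (v ⬝ᵥ (Q *ᵥ (G *ᵥ v))) +
      ε ^ 2 * ((G *ᵥ v) ⬝ᵥ (Q *ᵥ (G *ᵥ v))) := by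
    have hBv : B *ᵥ v = v - ε • (G *ᵥ v) := by
      rw [hB, Matrix.sub_mulVec, Matrix.one_mulVec, Matrix.smul_mulVec]
    rw [hBv]
    simp only [Matrix.mulVec_sub, Matrix.mulVec_smul, dotProduct_sub, sub_dotProduct,
      dotProduct_smul, smul_dotProduct, smul_eq_mul]
    rw [Matrix.dotProduct_mulVec_comm_of_isSymm hQs (G *ᵥ v) v]
    ring
  have hpos : 0 ≤ (G *ᵥ v) ⬝ᵥ (Q *ᵥ (G *ᵥ v)) := (dotProduct_self_nonneg_real _).trans (hlow _)
  have hpos' := mul_nonneg (sq_nonneg ε) hpos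
  rw [div_mul_eq_mul_div, one_mul, div_le_iff₀ (by positivity)]
  linarith

end Lyapunov

section AlmostSupermartingale

lemma frequently_lt_of_summable_mul {α v : ℕ → ℝ} (hα : ∀ t, 0 ≤ α t) (hα' : ¬ Summable α)
    (h : Summable fun t => α t * v t) {ε : ℝ} (hε : 0 < ε) : ∃ᶠ t in atTop, v t < ε := by
  intro hev
  apply hα'
  refine Summable.of_norm_bounded_eventually_nat (h.mul_left ε⁻¹) ?_
  filter_upwards [hev] with t ht
  rw [Real.norm_of_nonneg (hα t), le_inv_mul_iff₀ hε, mul_comm]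
  exact mul_le_mul_of_nonneg_left (not_lt.1 ht) (hα t)

variable {Ω : Type*} [m0 : MeasurableSpace Ω] {μ : Measure Ω} [IsProbabilityMeasure μ]

/-- A nonnegative process with drift at most `-c α_t V_t + K α_t²` tends to zero. -/
lemma ae_tendsto_zero_of_setIntegral_drift {ℱ : Filtration ℕ m0} {V : ℕ → Ω → ℝ}
    (hV : ∀ t, StronglyMeasurable[ℱ t] (V t)) (hint : ∀ t, Integrable (V t) μ)
    (hnn : ∀ t ω, 0 ≤ V t ω) {c K : ℝ} (hc : 0 < c) (hK : 0 ≤ K) {α : ℕ → ℝ}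
    (hα : ∀ t, 0 ≤ α t) (hα1 : ¬ Summable α) (hα2 : Summable fun t => α t ^ 2)
    (hle : ∀ t s, MeasurableSet[ℱ t] s →
      ∫ ω in s, V (t + 1) ω ∂μ ≤ ∫ ω in s, (V t ω - c * α t * V t ω + K * α t ^ 2) ∂μ) :
    ∀ᵐ ω ∂μ, Tendsto (fun t => V t ω) atTop (𝓝 0) := by
  set S := ∑' t, α t ^ 2 with hS
  have hSle : ∀ t, ∑ k ∈ Finset.range t, α k ^ 2 ≤ S := fun t =>
    hα2.sum_le_tsum _ fun k _ => sq_nonneg _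
  have hvnn : ∀ t, 0 ≤ ∫ ω, V t ω ∂μ := fun t => integral_nonneg (hnn t)
  have hv : ∀ t, ∫ ω, V (t + 1) ω ∂μ ≤
      ∫ ω, V t ω ∂μ - c * (α t * ∫ ω, V t ω ∂μ) + K * α t ^ 2 := fun t => by
    have := hle t Set.univ MeasurableSet.univ
    have h1 : ∫ ω, (V t ω - c * α t * V t ω + K * α t ^ 2) ∂μ =
        ∫ ω, (V t ω - c * α t * V t ω) ∂μ + ∫ _, K * α t ^ 2 ∂μ :=
      integral_add ((hint t).sub ((hint t).const_mul _)) (integrable_const _)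
    rw [setIntegral_univ, setIntegral_univ, h1, integral_sub (hint t) ((hint t).const_mul _),
      integral_const_mul, integral_const] at this
    simpa [mul_assoc] using this
  have hsum : ∀ t, c * ∑ k ∈ Finset.range t, α k * ∫ ω, V k ω ∂μ + ∫ ω, V t ω ∂μ ≤
      ∫ ω, V 0 ω ∂μ + K * ∑ k ∈ Finset.range t, α k ^ 2 := fun t => by
    induction t with
    | zero => simp
    | succ t ih =>
      rw [Finset.sum_range_succ, Finset.sum_range_succ]
      linarith [hv t]
  have hbd : ∀ t, ∫ ω, V t ω ∂μ ≤ ∫ ω, V 0 ω ∂μ + K * S := fun t => by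
    have h1 := mul_nonneg hc.le (Finset.sum_nonneg (s := Finset.range t) fun k _ =>
      mul_nonneg (hα k) (hvnn k))
    have h2 := mul_le_mul_of_nonneg_left (hSle t) hK
    linarith [hsum t]
  have hsummable : Summable fun t => α t * ∫ ω, V t ω ∂μ := by
    refine summable_of_sum_range_le (c := (∫ ω, V 0 ω ∂μ + K * S) / c)
      (fun k => mul_nonneg (hα k) (hvnn k)) fun t => ?_
    rw [le_div_iff₀ hc, mul_comm]
    have h2 := mul_le_mul_of_nonneg_left (hSle t) hK
    linarith [hsum t, hvnn t]
  have hconv : ∀ᵐ ω ∂μ, ∃ l, Tendsto (fun t => V t ω) atTop (𝓝 l) := by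
    set W : ℕ → Ω → ℝ := fun t ω => K * ∑ k ∈ Finset.range t, α k ^ 2 - V t ω with hW
    have hWint : ∀ t, Integrable (W t) μ := fun t => (integrable_const _).sub (hint t)
    have hsub : Submartingale W ℱ μ := by
      refine submartingale_of_setIntegral_le_succ
        (fun t => stronglyMeasurable_const.sub (hV t)) hWint fun t s hs => ?_
      have h1 := hle t s hs
      have h2 : ∫ ω in s, (V t ω - c * α t * V t ω + K * α t ^ 2) ∂μ ≤
          ∫ ω in s, (V t ω + K * α t ^ 2) ∂μ := by
        refine integral_mono (((hint t).sub ((hint t).const_mul _)).add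
          (integrable_const _)).integrableOn ((hint t).add (integrable_const _)).integrableOn
          fun ω => ?_
        have := mul_nonneg (mul_nonneg hc.le (hα t)) (hnn t ω)
        simp only
        linarith
      simp only [hW]
      rw [integral_sub (integrable_const _) (hint _).integrableOn,
        integral_sub (integrable_const _) (hint _).integrableOn, Finset.sum_range_succ]
      rw [integral_add (hint _).integrableOn (integrable_const _)] at h2
      simp only [integral_const, smul_eq_mul] at h2 ⊢
      nlinarith
    have hbdd : ∀ t, eLpNorm (W t) 1 μ ≤ ((∫ ω, V 0 ω ∂μ + K * S + K * S).toNNReal : NNReal) := by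
      intro t
      rw [eLpNorm_one_eq_lintegral_enorm, ← ofReal_integral_norm_eq_lintegral_enorm (hWint t)]
      refine ENNReal.ofReal_le_ofReal ?_
      calc ∫ ω, ‖W t ω‖ ∂μ ≤ ∫ ω, (V t ω + K * S) ∂μ := by
            refine integral_mono (hWint t).norm ((hint t).add (integrable_const _)) fun ω => ?_
            have h1 := mul_le_mul_of_nonneg_left (hSle t) hK
            have h2 : 0 ≤ K * ∑ k ∈ Finset.range t, α k ^ 2 := by positivity
            have := hnn t ω
            simp only [hW, Real.norm_eq_abs]
            rw [abs_le]
            constructor <;> linarith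
        _ = ∫ ω, V t ω ∂μ + K * S := by
            rw [integral_add (hint t) (integrable_const _)]; simp
        _ ≤ _ := by linarith [hbd t]
    filter_upwards [hsub.exists_ae_tendsto_of_bdd hbdd] with ω ⟨l, hl⟩
    refine ⟨K * S - l, ?_⟩
    have := ((hα2.hasSum.tendsto_sum_nat).const_mul K).sub hl
    simpa [hW] using this
  have hliminf : ∫⁻ ω, liminf (fun t => ENNReal.ofReal (V t ω)) atTop ∂μ = 0 := by
    have hmeas : ∀ t, Measurable fun ω => ENNReal.ofReal (V t ω) := fun t =>
      ((hV t).mono (ℱ.le t)).measurable.ennreal_ofReal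
    refine le_antisymm ((lintegral_liminf_le hmeas).trans ?_) bot_le
    refine ENNReal.le_of_forall_pos_le_add fun ε hε _ => ?_
    rw [zero_add]
    refine liminf_le_of_frequently_le' ?_
    refine (frequently_lt_of_summable_mul hα hα1 hsummable hε).mono fun t ht => ?_
    rw [← ofReal_integral_eq_lintegral_ofReal (hint t) (.of_forall (hnn t))]
    exact ENNReal.ofReal_le_of_le_toReal (by simpa using ht.le)
  have hzero := (lintegral_eq_zero_iff (Measurable.liminf fun t =>
    ((hV t).mono (ℱ.le t)).measurable.ennreal_ofReal)).1 hliminf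
  filter_upwards [hconv, hzero] with ω ⟨l, hl⟩ h0
  have h1 := (ENNReal.tendsto_ofReal hl).liminf_eq
  rw [h0] at h1
  have h2 : l ≤ 0 := ENNReal.ofReal_eq_zero.1 h1.symm
  have h3 : 0 ≤ l := ge_of_tendsto' hl fun t => hnn t ω
  rwa [le_antisymm h2 h3] at hl

/-- The same with a drift bound `-c α_t V_t + K α_t² (1 + V_t)`. -/
lemma ae_tendsto_zero_of_setIntegral_drift' {ℱ : Filtration ℕ m0} {V : ℕ → Ω → ℝ}
    (hV : ∀ t, StronglyMeasurable[ℱ t] (V t)) (hint : ∀ t, Integrable (V t) μ)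
    (hnn : ∀ t ω, 0 ≤ V t ω) {c K : ℝ} (hc : 0 < c) (hK : 0 ≤ K) {α : ℕ → ℝ}
    (hα : ∀ t, 0 ≤ α t) (hα1 : ¬ Summable α) (hα2 : Summable fun t => α t ^ 2)
    (hle : ∀ t s, MeasurableSet[ℱ t] s →
      ∫ ω in s, V (t + 1) ω ∂μ ≤
        ∫ ω in s, (V t ω - c * α t * V t ω + K * α t ^ 2 * (1 + V t ω)) ∂μ) :
    ∀ᵐ ω ∂μ, Tendsto (fun t => V t ω) atTop (𝓝 0) := by
  have hα0 : Tendsto α atTop (𝓝 0) := by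
    have := hα2.tendsto_atTop_zero.sqrt
    simpa [Real.sqrt_sq (hα _)] using this
  have hev : ∀ᶠ t in atTop, K * α t < c / 2 := by
    have := hα0.const_mul K
    rw [mul_zero] at this
    exact this.eventually_lt_const (by positivity)
  obtain ⟨T, hT⟩ := eventually_atTop.1 hev
  let 𝒢 : Filtration ℕ m0 :=
    ⟨fun t => ℱ (t + T), fun s t hst => ℱ.mono (Nat.add_le_add_right hst T), fun t => ℱ.le _⟩
  have key := ae_tendsto_zero_of_setIntegral_drift (μ := μ) (ℱ := 𝒢) (V := fun t => V (t + T))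
    (fun t => hV _) (fun t => hint _) (fun t => hnn _) (half_pos hc) hK
    (α := fun t => α (t + T)) (fun t => hα _) (by rwa [summable_nat_add_iff T])
    ((summable_nat_add_iff T).2 hα2) fun t s hs => by
      rw [add_right_comm]
      refine (hle (t + T) s hs).trans ?_
      have hi := hint (t + T)
      refine integral_mono (((hi.sub (hi.const_mul _)).add
        (((integrable_const _).add hi).const_mul _))).integrableOn
        ((hi.sub (hi.const_mul _)).add (integrable_const _)).integrableOn fun ω => ?_
      have h1 := hT (t + T) (Nat.le_add_left _ _)
      have h2 := mul_nonneg (hα (t + T)) (hnn (t + T) ω)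
      simp only
      nlinarith
  filter_upwards [key] with ω hω
  exact (tendsto_add_atTop_iff_nat T).1 hω

end AlmostSupermartingale

section Independence

variable {Ω E Z : Type*} [MeasurableSpace E] [MeasurableSpace Z]

/-- Freezing lemma: integrate out a variable that is independent of `m`. -/
lemma setLIntegral_comp_of_indep {m m0 : MeasurableSpace Ω} {μ : Measure Ω}
    [IsProbabilityMeasure μ] (hm : m ≤ m0) {X : Ω → E} {ζ : Ω → Z}
    (hX : Measurable[m] X) (hζ : Measurable ζ)
    (hind : Indep m (MeasurableSpace.comap ζ inferInstance) μ) {f : E × Z → ENNReal}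
    (hf : Measurable f) {s : Set Ω} (hs : MeasurableSet[m] s) :
    ∫⁻ ω in s, f (X ω, ζ ω) ∂μ = ∫⁻ ω in s, ∫⁻ z, f (X ω, z) ∂(μ.map ζ) ∂μ := by
  have hX0 : Measurable X := hX.mono hm le_rfl
  set Y : Ω → ENNReal × E := fun ω => (s.indicator 1 ω, X ω) with hY
  have hYm : Measurable[m] Y := Measurable.prodMk (Measurable.indicator measurable_const hs) hX
  have hY0 : Measurable Y := hYm.mono hm le_rfl
  have hYζ : IndepFun Y ζ μ := by
    rw [IndepFun_iff_Indep]
    exact indep_of_indep_of_le_left hind hYm.comap_le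
  have hmap := (indepFun_iff_map_prod_eq_prod_map_map hY0.aemeasurable hζ.aemeasurable).1 hYζ
  have : IsProbabilityMeasure (μ.map ζ) := Measure.isProbabilityMeasure_map hζ.aemeasurable
  have hg : Measurable fun p : (ENNReal × E) × Z => p.1.1 * f (p.1.2, p.2) := by fun_prop
  have h1 : ∫⁻ ω in s, f (X ω, ζ ω) ∂μ = ∫⁻ p, p.1.1 * f (p.1.2, p.2)
      ∂(μ.map fun ω => (Y ω, ζ ω)) := by
    rw [lintegral_map hg (by fun_prop), ← lintegral_indicator (hm s hs)]
    refine lintegral_congr fun ω => ?_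
    by_cases hω : ω ∈ s <;> simp [hY, hω]
  have hg2 : Measurable fun y : ENNReal × E => ∫⁻ z, y.1 * f (y.2, z) ∂(μ.map ζ) :=
    Measurable.lintegral_prod_right hg
  rw [h1, hmap, lintegral_prod _ hg.aemeasurable, lintegral_map hg2 hY0,
    ← lintegral_indicator (hm s hs)]
  refine lintegral_congr fun ω => ?_
  by_cases hω : ω ∈ s <;> simp [hY, hω]

lemma indep_past_of_iIndepFun [MeasurableSpace Ω] {μ : Measure Ω}
    {ζ : ℕ → Ω → Z} (hζ : ∀ t, Measurable (ζ t)) (h : iIndepFun ζ μ)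
    (t : ℕ) : Indep (⨆ k ∈ Set.Iio t, MeasurableSpace.comap (ζ k) inferInstance)
      (MeasurableSpace.comap (ζ t) inferInstance) μ := by
  have := indep_iSup_of_disjoint (fun k => (hζ k).comap_le) h
    (S := Set.Iio t) (T := {t}) (by simp)
  simpa using this

end Independence

section LinearStochasticApproximation

variable {m : Type*} [Fintype m]

lemma dotProduct_mulVec_self_le (Q : Matrix m m ℝ) (v : m → ℝ) :
    v ⬝ᵥ (Q *ᵥ v) ≤ (1 + ∑ i, ∑ j, Q i j ^ 2) * (v ⬝ᵥ v) := by
  have h1 := Matrix.mulVec_dotProduct_self_le Q v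
  have h2 := dotProduct_self_nonneg_real (v - Q *ᵥ v)
  have h3 := dotProduct_self_nonneg_real v
  have h4 := dotProduct_self_nonneg_real (Q *ᵥ v)
  simp only [dotProduct_sub, sub_dotProduct, dotProduct_comm (Q *ᵥ v) v] at h2
  linarith

lemma Matrix.mulVec_sub_dotProduct_self_le (Γ : Matrix m m ℝ) (v g : m → ℝ) :
    (Γ *ᵥ v - g) ⬝ᵥ (Γ *ᵥ v - g) ≤
      2 * ((∑ i, ∑ j, Γ i j ^ 2) * (v ⬝ᵥ v)) + 2 * ∑ i, g i ^ 2 := by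
  have h1 := Matrix.mulVec_dotProduct_self_le Γ v
  have h2 := dotProduct_self_nonneg_real (Γ *ᵥ v + g)
  have h3 : ∑ i, g i ^ 2 = g ⬝ᵥ g := by simp [dotProduct, pow_two]
  simp only [dotProduct_sub, sub_dotProduct, dotProduct_add, add_dotProduct] at h2 ⊢
  linarith

lemma dotProduct_mulVec_sub_smul {Q : Matrix m m ℝ} (hQ : Qᵀ = Q) (v u : m → ℝ) (a : ℝ) :
    (v - a • u) ⬝ᵥ (Q *ᵥ (v - a • u)) =
      v ⬝ᵥ (Q *ᵥ v) - 2 * a * (v ⬝ᵥ (Q *ᵥ u)) + a ^ 2 * (u ⬝ᵥ (Q *ᵥ u)) := by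
  simp only [Matrix.mulVec_sub, Matrix.mulVec_smul, dotProduct_sub, sub_dotProduct,
    dotProduct_smul, smul_dotProduct, smul_eq_mul]
  rw [Matrix.dotProduct_mulVec_comm_of_isSymm hQ u v]
  ring

variable {𝒵 : Type*} [MeasurableSpace 𝒵] {ν : Measure 𝒵}
  {Γ : 𝒵 → Matrix m m ℝ} {g : 𝒵 → m → ℝ} {G Q : Matrix m m ℝ}

lemma integral_dotProduct_mulVec_sub (hΓ : ∀ i j, Integrable (fun z => Γ z i j) ν)
    (hg : ∀ i, Integrable (fun z => g z i) ν) (hG : ∀ i j, ∫ z, Γ z i j ∂ν = G i j)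
    (hg0 : ∀ i, ∫ z, g z i ∂ν = 0) (u v : m → ℝ) :
    Integrable (fun z => u ⬝ᵥ (Γ z *ᵥ v - g z)) ν ∧
      ∫ z, u ⬝ᵥ (Γ z *ᵥ v - g z) ∂ν = u ⬝ᵥ (G *ᵥ v) := by
  have hi : ∀ i, Integrable (fun z => ∑ j, Γ z i j * v j) ν := fun i =>
    integrable_finsetSum _ fun j _ => (hΓ i j).mul_const _
  have hi' : ∀ i, Integrable (fun z => u i * (∑ j, Γ z i j * v j - g z i)) ν := fun i =>
    ((hi i).sub (hg i)).const_mul _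
  simp only [dotProduct, Matrix.mulVec, Pi.sub_apply]
  refine ⟨integrable_finsetSum _ fun i _ => hi' i, ?_⟩
  rw [integral_finsetSum _ fun i _ => hi' i]
  refine Finset.sum_congr rfl fun i _ => ?_
  rw [integral_const_mul, integral_sub (hi i) (hg i), hg0, sub_zero,
    integral_finsetSum _ fun j _ => (hΓ i j).mul_const _]
  simp only [integral_mul_const, hG]

/-- One-step drift of the Lyapunov function `v ↦ v · Q v`. -/
lemma exists_lintegral_lyapunov_drift [IsProbabilityMeasure ν]
    (hΓ : ∀ i j, MemLp (fun z => Γ z i j) 2 ν)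
    (hg : ∀ i, MemLp (fun z => g z i) 2 ν) (hG : ∀ i j, ∫ z, Γ z i j ∂ν = G i j)
    (hg0 : ∀ i, ∫ z, g z i ∂ν = 0) (hQ : Qᵀ = Q) (hQ1 : ∀ v, v ⬝ᵥ v ≤ v ⬝ᵥ (Q *ᵥ v))
    {c : ℝ} (hc : 0 < c) (hQ2 : ∀ v, c * (v ⬝ᵥ v) ≤ v ⬝ᵥ (Q *ᵥ (G *ᵥ v))) :
    ∃ c' > 0, ∃ K ≥ 0, ∀ (v : m → ℝ) (a : ℝ), 0 ≤ a →
      0 ≤ v ⬝ᵥ (Q *ᵥ v) - c' * a * (v ⬝ᵥ (Q *ᵥ v)) + K * a ^ 2 * (1 + v ⬝ᵥ (Q *ᵥ v)) ∧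
      ∫⁻ z, ENNReal.ofReal ((v - a • (Γ z *ᵥ v - g z)) ⬝ᵥ (Q *ᵥ (v - a • (Γ z *ᵥ v - g z)))) ∂ν ≤
        ENNReal.ofReal (v ⬝ᵥ (Q *ᵥ v) - c' * a * (v ⬝ᵥ (Q *ᵥ v)) +
          K * a ^ 2 * (1 + v ⬝ᵥ (Q *ᵥ v))) := by
  set q : ℝ := 1 + ∑ i, ∑ j, Q i j ^ 2 with hq
  have hq1 : 0 < q := by positivity
  set F : 𝒵 → ℝ := fun z => ∑ i, ∑ j, Γ z i j ^ 2 with hF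
  set D : 𝒵 → ℝ := fun z => ∑ i, g z i ^ 2 with hD
  have hFi : Integrable F ν := integrable_finsetSum _ fun i _ =>
    integrable_finsetSum _ fun j _ => (hΓ i j).integrable_sq
  have hDi : Integrable D ν := integrable_finsetSum _ fun i _ => (hg i).integrable_sq
  have hF0 : 0 ≤ ∫ z, F z ∂ν := integral_nonneg fun z => by positivity
  have hD0 : 0 ≤ ∫ z, D z ∂ν := integral_nonneg fun z => by positivity
  refine ⟨2 * c / q, by positivity, 2 * q * (∫ z, F z ∂ν + ∫ z, D z ∂ν), by positivity,
    fun v a ha => ?_⟩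
  obtain ⟨hI, hI'⟩ := integral_dotProduct_mulVec_sub
    (fun i j => (hΓ i j).integrable one_le_two) (fun i => (hg i).integrable one_le_two) hG hg0
    (Q *ᵥ v) v
  set Φ : 𝒵 → ℝ := fun z => v ⬝ᵥ (Q *ᵥ v) - 2 * a * ((Q *ᵥ v) ⬝ᵥ (Γ z *ᵥ v - g z)) +
    a ^ 2 * (q * (2 * (F z * (v ⬝ᵥ v)) + 2 * D z)) with hΦ
  have hVΦ : ∀ z, (v - a • (Γ z *ᵥ v - g z)) ⬝ᵥ (Q *ᵥ (v - a • (Γ z *ᵥ v - g z))) ≤ Φ z := by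
    intro z
    have h1 := dotProduct_mulVec_self_le Q (Γ z *ᵥ v - g z)
    have h2 := mul_le_mul_of_nonneg_left
      (Matrix.mulVec_sub_dotProduct_self_le (Γ z) v (g z)) hq1.le
    have h3 := mul_le_mul_of_nonneg_left (h1.trans h2) (sq_nonneg a)
    rw [dotProduct_mulVec_sub_smul hQ, Matrix.dotProduct_mulVec_comm_of_isSymm hQ v (_ - _),
      dotProduct_comm (_ - _) (Q *ᵥ v)]
    simp only [hΦ]
    linarith
  have hΦ1 : Integrable (fun z => v ⬝ᵥ (Q *ᵥ v) - 2 * a * ((Q *ᵥ v) ⬝ᵥ (Γ z *ᵥ v - g z))) ν :=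
    (integrable_const _).sub (hI.const_mul _)
  have hΦ3 : Integrable (fun z => 2 * (F z * (v ⬝ᵥ v)) + 2 * D z) ν :=
    ((hFi.mul_const _).const_mul _).add (hDi.const_mul _)
  have hΦ2 : Integrable (fun z => a ^ 2 * (q * (2 * (F z * (v ⬝ᵥ v)) + 2 * D z))) ν :=
    (hΦ3.const_mul _).const_mul _
  have hΦi : Integrable Φ ν := hΦ1.add hΦ2
  have hΦint : ∫ z, Φ z ∂ν = v ⬝ᵥ (Q *ᵥ v) - 2 * a * (v ⬝ᵥ (Q *ᵥ (G *ᵥ v))) +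
      a ^ 2 * (q * (2 * ((∫ z, F z ∂ν) * (v ⬝ᵥ v)) + 2 * ∫ z, D z ∂ν)) := by
    rw [hΦ, integral_add hΦ1 hΦ2, integral_sub (integrable_const _) (hI.const_mul _),
      integral_const_mul, hI', integral_const_mul, integral_const_mul,
      integral_add ((hFi.mul_const _).const_mul _) (hDi.const_mul _), integral_const_mul,
      integral_mul_const, integral_const_mul,
      Matrix.dotProduct_mulVec_comm_of_isSymm hQ v (G *ᵥ v), dotProduct_comm (G *ᵥ v) (Q *ᵥ v)]
    simp
  have hVnn : ∀ u : m → ℝ, 0 ≤ u ⬝ᵥ (Q *ᵥ u) := fun u =>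
    (dotProduct_self_nonneg_real u).trans (hQ1 u)
  have hΦle : ∫ z, Φ z ∂ν ≤ v ⬝ᵥ (Q *ᵥ v) - 2 * c / q * a * (v ⬝ᵥ (Q *ᵥ v)) +
      2 * q * (∫ z, F z ∂ν + ∫ z, D z ∂ν) * a ^ 2 * (1 + v ⬝ᵥ (Q *ᵥ v)) := by
    have h1 : 2 * c / q * a * (v ⬝ᵥ (Q *ᵥ v)) ≤ 2 * a * (v ⬝ᵥ (Q *ᵥ (G *ᵥ v))) := by
      have h2 := dotProduct_mulVec_self_le Q v
      have h3 := hQ2 v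
      calc 2 * c / q * a * (v ⬝ᵥ (Q *ᵥ v)) ≤ 2 * c / q * a * (q * (v ⬝ᵥ v)) := by gcongr
        _ = 2 * a * (c * (v ⬝ᵥ v)) := by field_simp
        _ ≤ _ := by gcongr
    have h3 : (∫ z, F z ∂ν) * (v ⬝ᵥ v) + ∫ z, D z ∂ν ≤
        (∫ z, F z ∂ν + ∫ z, D z ∂ν) * (1 + v ⬝ᵥ (Q *ᵥ v)) := by
      nlinarith [mul_le_mul_of_nonneg_left (hQ1 v) hF0, mul_nonneg hD0 (hVnn v)]
    have h4 := mul_le_mul_of_nonneg_left h3 (by positivity : 0 ≤ a ^ 2 * q * 2)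
    linarith
  have hΦ0 : ∀ z, 0 ≤ Φ z := fun z => (hVnn _).trans (hVΦ z)
  refine ⟨(integral_nonneg hΦ0).trans hΦle, ?_⟩
  calc _ ≤ ∫⁻ z, ENNReal.ofReal (Φ z) ∂ν :=
        lintegral_mono fun z => ENNReal.ofReal_le_ofReal (hVΦ z)
    _ = ENNReal.ofReal (∫ z, Φ z ∂ν) :=
        (ofReal_integral_eq_lintegral_ofReal hΦi (.of_forall hΦ0)).symm
    _ ≤ _ := ENNReal.ofReal_le_ofReal hΦle

variable {Ω : Type*} [MeasurableSpace Ω] {μ : Measure Ω} [IsProbabilityMeasure μ]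

/-- Linear stochastic approximation with i.i.d. coefficients and a mean matrix whose spectrum lies
in the open right half-plane. -/
theorem ae_tendsto_zero_of_linear_recursion [DecidableEq m]
    [IsProbabilityMeasure ν]
    (hΓm : ∀ i j, Measurable fun z => Γ z i j) (hgm : ∀ i, Measurable fun z => g z i)
    (hΓ : ∀ i j, MemLp (fun z => Γ z i j) 2 ν)
    (hg : ∀ i, MemLp (fun z => g z i) 2 ν) (hG : ∀ i j, ∫ z, Γ z i j ∂ν = G i j)
    (hg0 : ∀ i, ∫ z, g z i ∂ν = 0)
    (hspec : ∀ z ∈ spectrum ℂ (G.map (algebraMap ℝ ℂ)), 0 < z.re)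
    {ζ : ℕ → Ω → 𝒵} (hζ : ∀ t, Measurable (ζ t)) (hind : iIndepFun ζ μ)
    (hlaw : ∀ t, μ.map (ζ t) = ν) {α : ℕ → ℝ} (hα : ∀ t, 0 ≤ α t) (hα1 : ¬ Summable α)
    (hα2 : Summable fun t => α t ^ 2) {e : ℕ → Ω → m → ℝ} {e₀ : m → ℝ} (he0 : ∀ ω, e 0 ω = e₀)
    (he : ∀ t ω, e (t + 1) ω = e t ω - α t • (Γ (ζ t ω) *ᵥ e t ω - g (ζ t ω))) :
    ∀ᵐ ω ∂μ, Tendsto (fun t => e t ω) atTop (𝓝 0) := by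
  obtain ⟨Q, hQ, hQ1, c, hc, hQ2⟩ := Matrix.exists_lyapunov hspec
  obtain ⟨c', hc', K, hK, hdrift⟩ := exists_lintegral_lyapunov_drift hΓ hg hG hg0 hQ hQ1 hc hQ2
  have hVnn : ∀ u : m → ℝ, 0 ≤ u ⬝ᵥ (Q *ᵥ u) := fun u =>
    (dotProduct_self_nonneg_real u).trans (hQ1 u)
  have hVm : Measurable fun u : m → ℝ => u ⬝ᵥ (Q *ᵥ u) := by
    simp only [dotProduct, Matrix.mulVec]
    fun_prop
  have hUm : ∀ a : ℝ, Measurable fun p : (m → ℝ) × 𝒵 => p.1 - a • (Γ p.2 *ᵥ p.1 - g p.2) := by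
    intro a
    refine measurable_pi_iff.2 fun i => ?_
    simp only [Pi.sub_apply, Pi.smul_apply, Matrix.mulVec, dotProduct]
    have h1 : ∀ j, Measurable fun p : (m → ℝ) × 𝒵 => Γ p.2 i j := fun j =>
      (hΓm i j).comp measurable_snd
    have h2 : Measurable fun p : (m → ℝ) × 𝒵 => g p.2 i := (hgm i).comp measurable_snd
    fun_prop
  let ℱ : Filtration ℕ (inferInstance : MeasurableSpace Ω) :=
    ⟨fun t => ⨆ k ∈ Set.Iio t, MeasurableSpace.comap (ζ k) inferInstance,
      fun s t hst => biSup_mono fun k hk => lt_of_lt_of_le hk hst,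
      fun t => iSup₂_le fun k _ => (hζ k).comap_le⟩
  have hem : ∀ t, Measurable[ℱ t] (e t) := by
    intro t
    induction t with
    | zero => rw [show e 0 = fun _ => e₀ from funext he0]; exact measurable_const
    | succ t ih =>
      have h1 : Measurable[ℱ (t + 1)] (e t) := ih.mono (ℱ.mono t.le_succ) le_rfl
      have h2 : Measurable[ℱ (t + 1)] (ζ t) :=
        (comap_measurable (ζ t)).mono (le_biSup (fun k => MeasurableSpace.comap (ζ k) inferInstance)
          (Set.mem_Iio.2 t.lt_succ_self)) le_rfl
      rw [show e (t + 1) = fun ω => e t ω - α t • (Γ (ζ t ω) *ᵥ e t ω - g (ζ t ω)) from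
        funext (he t)]
      exact (hUm (α t)).comp (h1.prodMk h2)
  set V : ℕ → Ω → ℝ := fun t ω => e t ω ⬝ᵥ (Q *ᵥ e t ω) with hV
  have hVF : ∀ t, Measurable[ℱ t] (V t) := fun t => hVm.comp (hem t)
  have hVm0 : ∀ t, Measurable (V t) := fun t => (hVF t).mono (ℱ.le t) le_rfl
  have hstep : ∀ t s, MeasurableSet[ℱ t] s → ∫⁻ ω in s, ENNReal.ofReal (V (t + 1) ω) ∂μ ≤
      ∫⁻ ω in s, ENNReal.ofReal (V t ω - c' * α t * V t ω + K * α t ^ 2 * (1 + V t ω)) ∂μ := by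
    intro t s hs
    have h1 := setLIntegral_comp_of_indep (ℱ.le t) (hem t) (hζ t)
      (indep_past_of_iIndepFun hζ hind t)
      (f := fun p => ENNReal.ofReal ((p.1 - α t • (Γ p.2 *ᵥ p.1 - g p.2)) ⬝ᵥ
        (Q *ᵥ (p.1 - α t • (Γ p.2 *ᵥ p.1 - g p.2)))))
      (hVm.comp (hUm (α t))).ennreal_ofReal hs
    simp only [hV, he]
    rw [h1, hlaw t]
    exact lintegral_mono fun ω => (hdrift (e t ω) (α t) (hα t)).2
  have hRHSint : ∀ t, Integrable (V t) μ →
      Integrable (fun ω => V t ω - c' * α t * V t ω + K * α t ^ 2 * (1 + V t ω)) μ := fun t h =>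
    (h.sub (h.const_mul _)).add (((integrable_const _).add h).const_mul _)
  have hVint : ∀ t, Integrable (V t) μ := by
    intro t
    induction t with
    | zero =>
      have : V 0 = fun _ => e₀ ⬝ᵥ (Q *ᵥ e₀) := by funext ω; simp only [hV, he0]
      rw [this]
      exact integrable_const _
    | succ t ih =>
      refine ⟨(hVm0 _).aestronglyMeasurable, ?_⟩
      rw [hasFiniteIntegral_iff_ofReal (.of_forall fun ω => hVnn _)]
      have := hstep t Set.univ MeasurableSet.univ
      rw [setLIntegral_univ, setLIntegral_univ] at this
      exact this.trans_lt (hRHSint t ih).lintegral_lt_top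
  have hRHSnn : ∀ t ω, 0 ≤ V t ω - c' * α t * V t ω + K * α t ^ 2 * (1 + V t ω) := fun t ω =>
    (hdrift (e t ω) (α t) (hα t)).1
  have hVtend := ae_tendsto_zero_of_setIntegral_drift' (fun t => (hVF t).stronglyMeasurable) hVint
    (fun t ω => hVnn _) hc' hK hα hα1 hα2 fun t s hs => by
      rw [integral_eq_lintegral_of_nonneg_ae (.of_forall fun ω => hVnn _)
        (hVm0 _).aestronglyMeasurable,
        integral_eq_lintegral_of_nonneg_ae (.of_forall fun ω => hRHSnn t ω)
        (hRHSint t (hVint t)).aestronglyMeasurable.restrict]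
      exact ENNReal.toReal_mono (hRHSint t (hVint t)).integrableOn.lintegral_lt_top.ne
        (hstep t s hs)
  filter_upwards [hVtend] with ω hω
  refine tendsto_pi_nhds.2 fun i => ?_
  have h1 : Tendsto (fun t => e t ω i ^ 2) atTop (𝓝 0) := by
    refine squeeze_zero (fun t => sq_nonneg _) (fun t => ?_) hω
    refine le_trans ?_ (hQ1 (e t ω))
    rw [pow_two]
    exact Finset.single_le_sum (f := fun i => e t ω i * e t ω i)
      (fun j _ => mul_self_nonneg _) (Finset.mem_univ i)
  have h2 := h1.sqrt
  simp only [Real.sqrt_sq_eq_abs, Real.sqrt_zero] at h2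
  exact (tendsto_zero_iff_abs_tendsto_zero _).2 h2

end LinearStochasticApproximation

/-- The random matrix of the TDRC recursion, seen as a linear recursion for `(h, w)`. -/
noncomputable def tdrcMatrix {n : ℕ} (γ η β : ℝ) (z : Sample n) :
    Matrix (Fin n ⊕ Fin n) (Fin n ⊕ Fin n) ℝ :=
  Matrix.fromBlocks (η • (Matrix.vecMulVec z.1 z.1 + β • (1 : Matrix (Fin n) (Fin n) ℝ)))
    ((η * z.2.2.2) • Matrix.vecMulVec z.1 (z.1 - γ • z.2.2.1))
    ((z.2.2.2 * γ) • Matrix.vecMulVec z.2.2.1 z.1)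
    (z.2.2.2 • Matrix.vecMulVec z.1 (z.1 - γ • z.2.2.1))

/-- The inhomogeneous term of the TDRC recursion centred at `(0, w)`. -/
noncomputable def tdrcNoise {n : ℕ} (γ η : ℝ) (w : Fin n → ℝ) (z : Sample n) :
    Fin n ⊕ Fin n → ℝ :=
  Sum.elim (fun i => η * (z.2.2.2 * (z.2.1 - (z.1 - γ • z.2.2.1) ⬝ᵥ w) * z.1 i))
    (fun i => z.2.2.2 * (z.2.1 - (z.1 - γ • z.2.2.1) ⬝ᵥ w) * z.1 i)

lemma tdrcStep_centred {n : ℕ} (γ η β α : ℝ) (w₀ : Fin n → ℝ) (p : (Fin n → ℝ) × (Fin n → ℝ))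
    (z : Sample n) :
    Sum.elim (tdrcStep γ η β α p z).1 ((tdrcStep γ η β α p z).2 - w₀) =
      Sum.elim p.1 (p.2 - w₀) -
        α • (tdrcMatrix γ η β z *ᵥ Sum.elim p.1 (p.2 - w₀) - tdrcNoise γ η w₀ z) := by
  obtain ⟨h, w⟩ := p
  obtain ⟨x, R, x', ρ⟩ := z
  rw [tdrcMatrix, Matrix.fromBlocks_mulVec]
  simp only [Sum.elim_comp_inl, Sum.elim_comp_inr, Matrix.smul_mulVec, Matrix.add_mulVec,
    Matrix.vecMulVec_mulVec, Matrix.one_mulVec, tdrcStep, tdrcNoise]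
  funext i
  rcases i with i | i
  · simp [sub_dotProduct, dotProduct_sub, dotProduct_comm h x, dotProduct_comm w]
    ring
  · simp [sub_dotProduct, dotProduct_sub, dotProduct_comm h x, dotProduct_comm w]
    ring

namespace OffPolicyProblem

variable {S A : Type*} [MeasurableSpace S] [MeasurableSpace A] {n : ℕ} (M : OffPolicyProblem S A n)

lemma ofReal_ratio_mul (hcov : M.Coverage) (s : S) (a : A) :
    ENNReal.ofReal (M.ratio (s, a)) * M.b s {a} = M.π s {a} := by
  by_cases hb : M.b s {a} = 0
  · have : M.π s {a} = 0 := by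
      by_contra h
      exact (hcov s a (pos_iff_ne_zero.2 h)).ne' hb
    rw [hb, this, mul_zero]
  · have hb' : 0 < (M.b s).real {a} := ENNReal.toReal_pos hb (measure_ne_top _ _)
    rw [ratio, ENNReal.ofReal_div_of_pos hb', ofReal_measureReal, ofReal_measureReal]
    exact ENNReal.div_mul_cancel hb (measure_ne_top _ _)

lemma ratio_nonneg (p : S × A) : 0 ≤ M.ratio p := div_nonneg measureReal_nonneg measureReal_nonneg

instance (κ : Kernel S A) [IsMarkovKernel κ] : IsProbabilityMeasure (M.transitionLaw κ) := by
  unfold transitionLaw; infer_instance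

lemma integral_state (κ : Kernel S A) [IsMarkovKernel κ] {f : S → ℝ} (hf : Measurable f) :
    ∫ q, f q.1.1 ∂(M.transitionLaw κ) = ∫ s, f s ∂M.d := by
  have h1 : (M.transitionLaw κ).map (fun q => q.1.1) = M.d := by
    have : (M.transitionLaw κ).fst.fst = M.d := by
      unfold transitionLaw
      rw [Measure.fst_compProd, Measure.fst_compProd]
    rw [Measure.fst, Measure.fst, Measure.map_map measurable_fst measurable_fst] at this
    exact this
  conv_rhs => rw [← h1]
  rw [integral_map (by fun_prop) hf.aestronglyMeasurable]

variable {M} in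
lemma tdError_eq (w : Fin n → ℝ) (i : Fin n) (q : (S × A) × (ℝ × S)) :
    M.ratio q.1 * (q.2.1 - (M.x q.1.1 - M.γ • M.x q.2.2) ⬝ᵥ w) * M.x q.1.1 i =
      M.ratio q.1 * q.2.1 * M.x q.1.1 i -
        ∑ j, M.ratio q.1 * (M.x q.1.1 i * (M.x q.1.1 j - M.γ * M.x q.2.2 j)) * w j := by
  have : ∑ j, M.ratio q.1 * (M.x q.1.1 i * (M.x q.1.1 j - M.γ * M.x q.2.2 j)) * w j =
      M.ratio q.1 * M.x q.1.1 i * ((M.x q.1.1 - M.γ • M.x q.2.2) ⬝ᵥ w) := by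
    rw [dotProduct, Finset.mul_sum]
    refine Finset.sum_congr rfl fun j _ => ?_
    simp only [Pi.sub_apply, Pi.smul_apply, smul_eq_mul]
    ring
  rw [this]
  ring

lemma transpose_C : M.Cᵀ = M.C := by
  ext i j
  simp only [C, Matrix.transpose_apply, Matrix.of_apply, mul_comm]

lemma measurable_ratio [Countable A] [MeasurableSingletonClass A]
    : Measurable M.ratio := by
  refine measurable_from_prod_countable_left fun a => ?_
  have h1 := (Kernel.measurable_coe M.π (measurableSet_singleton a)).ennreal_toReal
  have h2 := (Kernel.measurable_coe M.b (measurableSet_singleton a)).ennreal_toReal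
  exact h1.div h2

lemma measurable_observe [Countable A] [MeasurableSingletonClass A]
    : Measurable M.observe := by
  have h1 := M.measurable_ratio
  have h2 := M.measurable_x
  unfold observe
  fun_prop

/-- Importance sampling: the ratio is the density of the target law. -/
lemma transitionLaw_target_eq_withDensity [Countable A] [MeasurableSingletonClass A]
    (hcov : M.Coverage) :
    M.transitionLaw M.π =
      (M.transitionLaw M.b).withDensity fun q => ENNReal.ofReal (M.ratio q.1) := by
  have hr : Measurable fun q : (S × A) × (ℝ × S) => ENNReal.ofReal (M.ratio q.1) :=
    (M.measurable_ratio.comp measurable_fst).ennreal_ofReal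
  have hr' : Measurable fun p : S × A => ENNReal.ofReal (M.ratio p) :=
    M.measurable_ratio.ennreal_ofReal
  refine Measure.ext_of_lintegral _ fun f hf => ?_
  have hF : Measurable fun p : S × A => ∫⁻ q, f (p, q) ∂(M.P p) :=
    hf.lintegral_kernel_prod_right'
  rw [lintegral_withDensity_eq_lintegral_mul _ hr hf]
  unfold transitionLaw
  rw [Measure.lintegral_compProd hf, Measure.lintegral_compProd hF,
    Measure.lintegral_compProd (hr.mul hf)]
  simp only [Pi.mul_apply]
  have h1 : ∀ p : S × A, ∫⁻ q, ENNReal.ofReal (M.ratio p) * f (p, q) ∂(M.P p) =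
      ENNReal.ofReal (M.ratio p) * ∫⁻ q, f (p, q) ∂(M.P p) := fun p =>
    lintegral_const_mul _ (hf.comp measurable_prodMk_left)
  simp only [h1]
  have h2 := Measure.lintegral_compProd (μ := M.d) (κ := M.b) (hr'.mul hF)
  simp only [Pi.mul_apply] at h2
  rw [h2]
  refine lintegral_congr fun s => ?_
  rw [lintegral_countable', lintegral_countable']
  refine tsum_congr fun a => ?_
  rw [← M.ofReal_ratio_mul hcov]
  ring

lemma integral_target [Countable A] [MeasurableSingletonClass A]
    (hcov : M.Coverage) (f : (S × A) × (ℝ × S) → ℝ) :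
    ∫ q, f q ∂(M.transitionLaw M.π) = ∫ q, M.ratio q.1 * f q ∂(M.transitionLaw M.b) := by
  have hr : Measurable fun q : (S × A) × (ℝ × S) => ENNReal.ofReal (M.ratio q.1) :=
    (M.measurable_ratio.comp measurable_fst).ennreal_ofReal
  rw [M.transitionLaw_target_eq_withDensity hcov, integral_withDensity_eq_integral_toReal_smul hr
    (.of_forall fun _ => ENNReal.ofReal_lt_top)]
  simp [ENNReal.toReal_ofReal (M.ratio_nonneg _)]

/-- Finite second moments of the products that enter one update. -/
structure ProductMoments : Prop where
  reward : ∀ i, MemLp (fun q => M.ratio q.1 * q.2.1 * M.x q.1.1 i) 2 (M.transitionLaw M.b)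
  feature : ∀ i j, MemLp (fun q => M.x q.1.1 i * M.x q.1.1 j) 2 (M.transitionLaw M.b)
  ratio_feature : ∀ i j,
    MemLp (fun q => M.ratio q.1 * M.x q.1.1 i * M.x q.1.1 j) 2 (M.transitionLaw M.b)
  ratio_next : ∀ i j,
    MemLp (fun q => M.ratio q.1 * M.x q.1.1 i * M.x q.2.2 j) 2 (M.transitionLaw M.b)

lemma FiniteSecondMoments.productMoments [Countable A] [MeasurableSingletonClass A]
    (hmom : M.FiniteSecondMoments) : M.ProductMoments := by
  rcases hmom with ⟨_, _, hR⟩ | h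
  · have hrm := M.measurable_ratio
    have hxm : ∀ i, Measurable fun s => M.x s i := fun i => measurable_pi_iff.1 M.measurable_x i
    obtain ⟨B, hB⟩ := (Set.finite_range fun p : S × A => |M.ratio p|).bddAbove
    have hB : ∀ p, |M.ratio p| ≤ B := fun p => hB ⟨p, rfl⟩
    obtain ⟨D, hD⟩ := (Set.finite_range fun p : S × Fin n => |M.x p.1 p.2|).bddAbove
    have hD : ∀ s i, |M.x s i| ≤ D := fun s i => hD ⟨(s, i), rfl⟩
    refine ⟨fun i => ?_, fun i j => ?_, fun i j => ?_, fun i j => ?_⟩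
    · refine hR.of_le_mul (c := B * D) (by fun_prop) (.of_forall fun q => ?_)
      simp only [Real.norm_eq_abs, abs_mul]
      calc |M.ratio q.1| * |q.2.1| * |M.x q.1.1 i| = |M.ratio q.1| * |M.x q.1.1 i| * |q.2.1| := by
            ring
        _ ≤ _ := by
            have h0 := (abs_nonneg _).trans (hB q.1)
            gcongr
            exacts [hB _, hD _ _]
    · refine MemLp.of_bound (by fun_prop) (D * D) (.of_forall fun q => ?_)
      have h0 := (abs_nonneg _).trans (hD q.1.1 i)
      simp only [Real.norm_eq_abs, abs_mul]
      gcongr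
      exacts [hD _ _, hD _ _]
    · refine MemLp.of_bound (by fun_prop) (B * D * D) (.of_forall fun q => ?_)
      have h0 := (abs_nonneg _).trans (hD q.1.1 i)
      have h1 := (abs_nonneg _).trans (hB q.1)
      simp only [Real.norm_eq_abs, abs_mul]
      gcongr
      exacts [hB _, hD _ _, hD _ _]
    · refine MemLp.of_bound (by fun_prop) (B * D * D) (.of_forall fun q => ?_)
      have h0 := (abs_nonneg _).trans (hD q.1.1 i)
      have h1 := (abs_nonneg _).trans (hB q.1)
      simp only [Real.norm_eq_abs, abs_mul]
      gcongr
      exacts [hB _, hD _ _, hD _ _]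
  · exact ⟨fun i => (h i).1, fun i j => ((h i).2 j).1, fun i j => ((h i).2 j).2.1,
      fun i j => ((h i).2 j).2.2⟩

variable {M}

lemma ProductMoments.memLp_ratio_sub (hM : M.ProductMoments) (i j : Fin n) :
    MemLp (fun q => M.ratio q.1 * (M.x q.1.1 i * (M.x q.1.1 j - M.γ * M.x q.2.2 j))) 2
      (M.transitionLaw M.b) := by
  convert (hM.ratio_feature i j).sub ((hM.ratio_next i j).const_mul M.γ) using 1
  funext q
  simp only [Pi.sub_apply]
  ring

lemma ProductMoments.memLp_tdError (hM : M.ProductMoments) (w : Fin n → ℝ) (i : Fin n) :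
    MemLp (fun q => M.ratio q.1 * (q.2.1 - (M.x q.1.1 - M.γ • M.x q.2.2) ⬝ᵥ w) * M.x q.1.1 i) 2
      (M.transitionLaw M.b) := by
  simp only [tdError_eq]
  exact (hM.reward i).sub (memLp_finsetSum _ fun j _ => (hM.memLp_ratio_sub i j).mul_const _)

lemma integral_ratio_sub [Countable A] [MeasurableSingletonClass A]
    (hcov : M.Coverage) (i j : Fin n) :
    ∫ q, M.ratio q.1 * (M.x q.1.1 i * (M.x q.1.1 j - M.γ * M.x q.2.2 j)) ∂(M.transitionLaw M.b) =
      M.Amat i j :=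
  (M.integral_target hcov _).symm

variable (M) in
/-- The vector `E_π[R x]`. -/
noncomputable def rewardVec : Fin n → ℝ := fun i =>
  ∫ q, M.ratio q.1 * q.2.1 * M.x q.1.1 i ∂(M.transitionLaw M.b)

lemma ProductMoments.integral_tdError [Countable A] [MeasurableSingletonClass A]
    (hM : M.ProductMoments) (hcov : M.Coverage) (w : Fin n → ℝ)
    (i : Fin n) :
    ∫ q, M.ratio q.1 * (q.2.1 - (M.x q.1.1 - M.γ • M.x q.2.2) ⬝ᵥ w) * M.x q.1.1 i
      ∂(M.transitionLaw M.b) = M.rewardVec i - (M.Amat *ᵥ w) i := by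
  have hi : ∀ j, Integrable (fun q => M.ratio q.1 *
      (M.x q.1.1 i * (M.x q.1.1 j - M.γ * M.x q.2.2 j)) * w j) (M.transitionLaw M.b) := fun j =>
    ((hM.memLp_ratio_sub i j).integrable one_le_two).mul_const _
  simp only [tdError_eq]
  rw [integral_sub ((hM.reward i).integrable one_le_two) (integrable_finsetSum _ fun j _ => hi j),
    integral_finsetSum _ fun j _ => hi j]
  simp only [integral_mul_const, integral_ratio_sub hcov]
  rfl

lemma ProductMoments.isTDFixedPoint_iff [Countable A] [MeasurableSingletonClass A]
    (hM : M.ProductMoments) (hcov : M.Coverage)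
    (w : Fin n → ℝ) : M.IsTDFixedPoint w ↔ M.Amat *ᵥ w = M.rewardVec := by
  have h : ∀ i, ∫ q, (q.2.1 + M.γ * (w ⬝ᵥ M.x q.2.2) - w ⬝ᵥ M.x q.1.1) * M.x q.1.1 i
      ∂(M.transitionLaw M.π) = M.rewardVec i - (M.Amat *ᵥ w) i := fun i => by
    rw [M.integral_target hcov, ← hM.integral_tdError hcov]
    refine integral_congr_ae (.of_forall fun q => ?_)
    beta_reduce
    rw [sub_dotProduct, smul_dotProduct, smul_eq_mul, dotProduct_comm w, dotProduct_comm w]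
    ring
  simp only [IsTDFixedPoint, h, sub_eq_zero, funext_iff]
  exact forall_congr' fun i => eq_comm

variable (M) in
lemma integral_feature (i j : Fin n) :
    ∫ q, M.x q.1.1 i * M.x q.1.1 j ∂(M.transitionLaw M.b) = M.C i j := by
  have hxm : ∀ i, Measurable fun s => M.x s i := fun i => measurable_pi_iff.1 M.measurable_x i
  exact M.integral_state M.b ((hxm i).mul (hxm j))

lemma integral_ratio_feature [Countable A] [MeasurableSingletonClass A]
    (hcov : M.Coverage) (i j : Fin n) :
    ∫ q, M.ratio q.1 * M.x q.1.1 i * M.x q.1.1 j ∂(M.transitionLaw M.b) = M.C i j := by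
  have hxm : ∀ i, Measurable fun s => M.x s i := fun i => measurable_pi_iff.1 M.measurable_x i
  have h1 := M.integral_target hcov fun q => M.x q.1.1 i * M.x q.1.1 j
  simp only [mul_assoc]
  exact h1.symm.trans (M.integral_state M.π ((hxm i).mul (hxm j)))

lemma ProductMoments.integral_ratio_next [Countable A] [MeasurableSingletonClass A]
    (hM : M.ProductMoments) (hcov : M.Coverage)
    (i j : Fin n) :
    M.γ * ∫ q, M.ratio q.1 * M.x q.1.1 i * M.x q.2.2 j ∂(M.transitionLaw M.b) =
      M.C i j - M.Amat i j := by
  rw [← integral_ratio_sub hcov, ← integral_ratio_feature hcov, ← integral_const_mul,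
    ← integral_sub ((hM.ratio_feature i j).integrable one_le_two)
      ((hM.memLp_ratio_sub i j).integrable one_le_two)]
  refine integral_congr_ae (.of_forall fun q => ?_)
  simp only
  ring

lemma ProductMoments.posDefForm_C (hM : M.ProductMoments) (hC : IsUnit M.C) :
    PosDefForm M.C := by
  have hpsd : M.C.PosSemidef := by
    refine Matrix.PosSemidef.of_dotProduct_mulVec_nonneg
      (by simpa [Matrix.IsHermitian] using M.transpose_C) fun v => ?_
    have hi : ∀ i j, Integrable (fun q => v i * (M.x q.1.1 i * M.x q.1.1 j * v j))
      (M.transitionLaw M.b) := fun i j =>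
      (((hM.feature i j).integrable one_le_two).mul_const _).const_mul _
    have : star v ⬝ᵥ (M.C *ᵥ v) = ∫ q, (∑ i, v i * M.x q.1.1 i) ^ 2 ∂(M.transitionLaw M.b) := by
      have h1 : ∀ q : (S × A) × (ℝ × S), (∑ i, v i * M.x q.1.1 i) ^ 2 =
          ∑ i, ∑ j, v i * (M.x q.1.1 i * M.x q.1.1 j * v j) := fun q => by
        rw [pow_two, Finset.sum_mul_sum]
        exact Finset.sum_congr rfl fun i _ => Finset.sum_congr rfl fun j _ => by ring
      simp only [h1]
      rw [integral_finsetSum _ fun i _ => integrable_finsetSum _ fun j _ => hi i j]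
      simp only [dotProduct, Matrix.mulVec, Finset.mul_sum]
      refine Finset.sum_congr rfl fun i _ => ?_
      rw [integral_finsetSum _ fun j _ => hi i j]
      refine Finset.sum_congr rfl fun j _ => ?_
      rw [integral_const_mul, integral_mul_const, M.integral_feature]
      simp
    rw [this]
    exact integral_nonneg fun q => sq_nonneg _
  exact ((hpsd.posDef_iff_isUnit).2 hC).posDefForm

section Recursion

variable (η β : ℝ)

variable (M) in
lemma measurable_tdrcMatrix (i j) : Measurable fun z : Sample n => tdrcMatrix M.γ η β z i j := by
  rcases i with i | i <;> rcases j with j | j <;>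
  · simp only [tdrcMatrix, Matrix.fromBlocks_apply₁₁, Matrix.fromBlocks_apply₁₂,
      Matrix.fromBlocks_apply₂₁, Matrix.fromBlocks_apply₂₂, Matrix.smul_apply, Matrix.add_apply,
      Matrix.vecMulVec_apply, Pi.sub_apply, Pi.smul_apply, smul_eq_mul]
    fun_prop

variable (M) in
lemma measurable_tdrcNoise (w : Fin n → ℝ) (i) :
    Measurable fun z : Sample n => tdrcNoise M.γ η w z i := by
  rcases i with i | i <;>
  · simp only [tdrcNoise, Sum.elim_inl, Sum.elim_inr, dotProduct, Pi.sub_apply, Pi.smul_apply,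
      smul_eq_mul]
    fun_prop

lemma ProductMoments.tdrcMatrix_moments [Countable A] [MeasurableSingletonClass A]
    (hM : M.ProductMoments) (hcov : M.Coverage) (i j) :
    MemLp (fun q => tdrcMatrix M.γ η β (M.observe q) i j) 2 (M.transitionLaw M.b) ∧
      ∫ q, tdrcMatrix M.γ η β (M.observe q) i j ∂(M.transitionLaw M.b) =
        Matrix.fromBlocks (η • (M.C + β • (1 : Matrix (Fin n) (Fin n) ℝ))) (η • M.Amat)
          (M.C - M.Amatᵀ) M.Amat i j := by
  have hsub := hM.memLp_ratio_sub
  rcases i with i | i <;> rcases j with j | j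
  · have h1 := hM.feature i j
    have h2 := memLp_const (p := 2) (μ := M.transitionLaw M.b)
      (β * (1 : Matrix (Fin n) (Fin n) ℝ) i j)
    refine ⟨(h1.add h2).const_mul η, ?_⟩
    refine (integral_const_mul η _).trans ?_
    have h3 := integral_add (h1.integrable one_le_two) (h2.integrable one_le_two)
    simp only [M.integral_feature, integral_const, probReal_univ, one_smul] at h3
    exact congrArg (η * ·) h3
  · have heq : (fun q => tdrcMatrix M.γ η β (M.observe q) (Sum.inl i) (Sum.inr j)) = fun q =>
        η * (M.ratio q.1 * (M.x q.1.1 i * (M.x q.1.1 j - M.γ * M.x q.2.2 j))) := by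
      funext q
      simp [tdrcMatrix, observe, Matrix.vecMulVec_apply, mul_assoc]
    rw [heq]
    refine ⟨(hsub i j).const_mul η, ?_⟩
    rw [integral_const_mul, integral_ratio_sub hcov]
    simp
  · have heq : (fun q => tdrcMatrix M.γ η β (M.observe q) (Sum.inr i) (Sum.inl j)) = fun q =>
        M.γ * (M.ratio q.1 * M.x q.1.1 j * M.x q.2.2 i) := by
      funext q
      simp [tdrcMatrix, observe, Matrix.vecMulVec_apply]
      ring
    rw [heq]
    refine ⟨(hM.ratio_next j i).const_mul M.γ, ?_⟩
    rw [integral_const_mul, hM.integral_ratio_next hcov]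
    simp [← congrFun (congrFun M.transpose_C i) j]
  · have heq : (fun q => tdrcMatrix M.γ η β (M.observe q) (Sum.inr i) (Sum.inr j)) = fun q =>
        M.ratio q.1 * (M.x q.1.1 i * (M.x q.1.1 j - M.γ * M.x q.2.2 j)) := by
      funext q
      simp [tdrcMatrix, observe, Matrix.vecMulVec_apply]
    rw [heq]
    refine ⟨hsub i j, ?_⟩
    rw [integral_ratio_sub hcov]
    simp

lemma ProductMoments.tdrcNoise_moments [Countable A] [MeasurableSingletonClass A]
    (hM : M.ProductMoments) (hcov : M.Coverage)
    {w : Fin n → ℝ} (hw : M.Amat *ᵥ w = M.rewardVec) (i) :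
    MemLp (fun q => tdrcNoise M.γ η w (M.observe q) i) 2 (M.transitionLaw M.b) ∧
      ∫ q, tdrcNoise M.γ η w (M.observe q) i ∂(M.transitionLaw M.b) = 0 := by
  have h0 : ∀ i, M.rewardVec i - (M.Amat *ᵥ w) i = 0 := fun i => by rw [hw, sub_self]
  rcases i with i | i
  · refine ⟨(hM.memLp_tdError w i).const_mul η, ?_⟩
    refine (integral_const_mul η _).trans ?_
    refine mul_eq_zero_of_right η ?_
    exact (hM.integral_tdError hcov w i).trans (h0 i)
  · exact ⟨hM.memLp_tdError w i, (hM.integral_tdError hcov w i).trans (h0 i)⟩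

end Recursion

end OffPolicyProblem

namespace OffPolicyProblem

variable {S A : Type*} [MeasurableSpace S] [MeasurableSpace A] {n : ℕ} {M : OffPolicyProblem S A n}

lemma transpose_H : M.Hᵀ = M.H := by
  rw [H, Matrix.transpose_smul, Matrix.transpose_add, Matrix.transpose_transpose, add_comm]

lemma posDefForm_H_iff : PosDefForm M.H ↔ PosDefForm M.Amat :=
  PosDefForm.congr_form fun v => dotProduct_half_add_transpose_mulVec _ v

lemma isUnit_Amat_of_lambdaMax_neg (hH : IsUnit M.H)
    (h : lambdaMax (M.H⁻¹ * (M.Amat * M.Amatᵀ)) < 0) : IsUnit M.Amat := by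
  rw [Matrix.isUnit_iff_isUnit_det, isUnit_iff_ne_zero, ← Matrix.det_transpose]
  intro h0
  obtain ⟨v, hv, hv0⟩ := Matrix.exists_mulVec_eq_zero_iff.2 h0
  have hmem : (0 : ℝ) ∈ spectrum ℝ (M.H⁻¹ * (M.Amat * M.Amatᵀ)) :=
    (Matrix.mem_spectrum_inv_mul_iff hH).2
      ⟨v, hv, by rw [← Matrix.mulVec_mulVec, hv0, Matrix.mulVec_zero, zero_smul]⟩
  exact (le_csSup (Matrix.finite_spectrum _).bddAbove hmem).not_gt h

/-- Each of the three cases of the theorem makes the mean system stable. -/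
lemma stability_of_cases {η β : ℝ} (hη : 0 < η) (hβ : 0 ≤ β) (hC : PosDefForm M.C)
    (hcases : PosDefForm M.Amat ∨
      (IsUnit M.H ∧ β < -lambdaMax (M.H⁻¹ * (M.Amat * M.Amatᵀ)) ∧
        η > -lambdaMin (M.C⁻¹ * M.H)) ∨
      (IsUnit M.H ∧ IsUnit M.Amat ∧ ¬ PosDefForm M.Amat ∧
        β < -lambdaMaxNeg (M.H⁻¹ * (M.Amat * M.Amatᵀ)) ∧
        η > -lambdaMin (M.C⁻¹ * M.H))) :
    IsUnit M.Amat ∧ PosDefForm (M.Amat * M.Amatᵀ + β • M.H) ∧ PosDefForm (η • M.C + M.H) := by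
  have key : ∀ (_ : IsUnit M.H) (_ : IsUnit M.Amat)
      (_ : ∀ z ∈ spectrum ℝ (M.H⁻¹ * (M.Amat * M.Amatᵀ)), z < 0 → β < -z)
      (_ : η > -lambdaMin (M.C⁻¹ * M.H)), IsUnit M.Amat ∧
        PosDefForm (M.Amat * M.Amatᵀ + β • M.H) ∧ PosDefForm (η • M.C + M.H) := by
    intro hH hA h1 h2
    refine ⟨hA, posDefForm_add_smul hβ (posDefForm_mul_transpose hA) (by simp) hH transpose_H h1,
      posDefForm_smul_add hC M.transpose_C transpose_H fun z hz => ?_⟩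
    have : lambdaMin (M.C⁻¹ * M.H) ≤ z := csInf_le (Matrix.finite_spectrum _).bddBelow hz
    linarith
  rcases hcases with hA | ⟨hH, h1, h2⟩ | ⟨hH, hA, -, h1, h2⟩
  · have hH := posDefForm_H_iff.2 hA
    refine ⟨hA.isUnit, fun v hv => ?_, fun v hv => ?_⟩
    · rw [Matrix.add_mulVec, Matrix.smul_mulVec, dotProduct_add, dotProduct_smul, smul_eq_mul]
      exact add_pos_of_pos_of_nonneg (posDefForm_mul_transpose hA.isUnit v hv)
        (mul_nonneg hβ (hH v hv).le)
    · rw [Matrix.add_mulVec, Matrix.smul_mulVec, dotProduct_add, dotProduct_smul, smul_eq_mul]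
      exact add_pos (mul_pos hη (hC v hv)) (hH v hv)
  · refine key hH (isUnit_Amat_of_lambdaMax_neg hH (by linarith)) (fun z hz _ => ?_) h2
    have : z ≤ lambdaMax (M.H⁻¹ * (M.Amat * M.Amatᵀ)) :=
      le_csSup (Matrix.finite_spectrum _).bddAbove hz
    linarith
  · refine key hH hA (fun z hz hz0 => ?_) h2
    have : z ≤ lambdaMaxNeg (M.H⁻¹ * (M.Amat * M.Amatᵀ)) :=
      le_csSup ((Matrix.finite_spectrum _).inter_of_left _).bddAbove ⟨hz, hz0⟩
    linarith

lemma ProductMoments.ae_tendsto_tdrc [Countable A] [MeasurableSingletonClass A]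
    (hM : M.ProductMoments) (hcov : M.Coverage) {η β : ℝ} (hη : 0 < η) (hβ : 0 ≤ β)
    (hC : PosDefForm M.C) (hK : PosDefForm (M.Amat * M.Amatᵀ + β • M.H))
    (hP : PosDefForm (η • M.C + M.H)) {w : Fin n → ℝ} (hw : M.Amat *ᵥ w = M.rewardVec)
    {Ω : Type*} [MeasurableSpace Ω] {μ : Measure Ω} [IsProbabilityMeasure μ]
    {Z : ℕ → Ω → Sample n} (hZ : ∀ t, Measurable (Z t)) (hind : iIndepFun Z μ)
    (hlaw : ∀ t, μ.map (Z t) = M.sampleLaw) {α : ℕ → ℝ} (hα : ∀ t, 0 ≤ α t)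
    (hα1 : ¬ Summable α) (hα2 : Summable fun t => α t ^ 2) (h₀ w₀ : Fin n → ℝ) :
    ∀ᵐ ω ∂μ, Tendsto (fun t => (tdrc M.γ η β α h₀ w₀ (fun s => Z s ω) t).2) atTop (𝓝 w) := by
  have hobs := M.measurable_observe
  have hΓm := M.measurable_tdrcMatrix η β
  have hgm := M.measurable_tdrcNoise η w
  have hmom := hM.tdrcMatrix_moments η β hcov
  have hnoise := hM.tdrcNoise_moments η hcov hw
  have hprob : IsProbabilityMeasure M.sampleLaw :=
    Measure.isProbabilityMeasure_map hobs.aemeasurable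
  have key := ae_tendsto_zero_of_linear_recursion (μ := μ) (ν := M.sampleLaw) hΓm hgm
    (fun i j => (memLp_map_measure_iff (hΓm i j).aestronglyMeasurable hobs.aemeasurable).2
      (hmom i j).1)
    (fun i => (memLp_map_measure_iff (hgm i).aestronglyMeasurable hobs.aemeasurable).2
      (hnoise i).1)
    (fun i j => (integral_map hobs.aemeasurable (hΓm i j).aestronglyMeasurable).trans (hmom i j).2)
    (fun i => (integral_map hobs.aemeasurable (hgm i).aestronglyMeasurable).trans (hnoise i).2)
    (fun z hz => re_pos_of_mem_spectrum_tdrc hη hβ M.transpose_C hC hK hP hz)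
    hZ hind hlaw hα hα1 hα2
    (e := fun t ω => Sum.elim (tdrc M.γ η β α h₀ w₀ (fun s => Z s ω) t).1
      ((tdrc M.γ η β α h₀ w₀ (fun s => Z s ω) t).2 - w))
    (e₀ := Sum.elim h₀ (w₀ - w)) (fun ω => rfl) (fun t ω => tdrcStep_centred _ _ _ _ _ _ _)
  filter_upwards [key] with ω hω
  refine tendsto_pi_nhds.2 fun i => ?_
  have := (tendsto_pi_nhds.1 hω (Sum.inr i)).add_const (w i)
  simpa using this

end OffPolicyProblem

theorem theorem1
    {S A Ω : Type*} [MeasurableSpace S] [MeasurableSpace A] [Countable A]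
    [MeasurableSingletonClass A] [MeasurableSpace Ω]
    (n : ℕ) (M : OffPolicyProblem S A n)
    (hcov : M.Coverage) (hmom : M.FiniteSecondMoments)
    (η β : ℝ) (hη : 0 < η) (hβ : 0 ≤ β)
    (hC : IsUnit M.C) (hAβ : IsUnit (M.Amat + β • (1 : Matrix (Fin n) (Fin n) ℝ))) :
    -- convergence
    ((PosDefForm M.Amat ∨
      (IsUnit M.H ∧ β < -lambdaMax (M.H⁻¹ * (M.Amat * M.Amatᵀ)) ∧
        η > -lambdaMin (M.C⁻¹ * M.H)) ∨
      (IsUnit M.H ∧ IsUnit M.Amat ∧ ¬ PosDefForm M.Amat ∧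
        β < -lambdaMaxNeg (M.H⁻¹ * (M.Amat * M.Amatᵀ)) ∧
        η > -lambdaMin (M.C⁻¹ * M.H))) →
      ∃ wTD : Fin n → ℝ, (∀ w, M.IsTDFixedPoint w ↔ w = wTD) ∧
        ∀ (μ : Measure Ω) [IsProbabilityMeasure μ] (Z : ℕ → Ω → Sample n),
          (∀ t, Measurable (Z t)) → iIndepFun Z μ → (∀ t, μ.map (Z t) = M.sampleLaw) →
        ∀ α : ℕ → ℝ, (∀ t, 0 < α t ∧ α t ≤ 1) → ¬ Summable α → Summable (fun t => α t ^ 2) →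
        ∀ h₀ w₀ : Fin n → ℝ,
          ∀ᵐ ω ∂μ, Tendsto (fun t => (tdrc M.γ η β α h₀ w₀ (fun s => Z s ω) t).2) atTop
            (𝓝 wTD)) ∧
    -- the bounds on `β` and `η` are real and positive when `A` is not positive definite
    (IsUnit M.H → ¬ PosDefForm M.Amat →
      RealSpectrum (M.H⁻¹ * (M.Amat * M.Amatᵀ)) ∧ RealSpectrum (M.C⁻¹ * M.H) ∧
      0 < -lambdaMin (M.C⁻¹ * M.H) ∧
      (IsUnit M.Amat → 0 < -lambdaMaxNeg (M.H⁻¹ * (M.Amat * M.Amatᵀ))) ∧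
      (PosDefForm (-M.Amat) → 0 < -lambdaMax (M.H⁻¹ * (M.Amat * M.Amatᵀ)))) := by
  have hM := hmom.productMoments
  have hCpd := hM.posDefForm_C hC
  have hHs := OffPolicyProblem.transpose_H (M := M)
  refine ⟨fun hcases => ?_, fun hH hA => ?_⟩
  · obtain ⟨hA, hK, hP⟩ := M.stability_of_cases hη hβ hCpd hcases
    have hdet := (Matrix.isUnit_iff_isUnit_det _).1 hA
    have hfix : M.Amat *ᵥ (M.Amat⁻¹ *ᵥ M.rewardVec) = M.rewardVec := by
      rw [Matrix.mulVec_mulVec, Matrix.mul_nonsing_inv _ hdet, Matrix.one_mulVec]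
    refine ⟨M.Amat⁻¹ *ᵥ M.rewardVec, fun w => ?_, ?_⟩
    · rw [hM.isTDFixedPoint_iff hcov]
      constructor
      · rintro h
        rw [← h, Matrix.mulVec_mulVec, Matrix.nonsing_inv_mul _ hdet, Matrix.one_mulVec]
      · rintro rfl
        exact hfix
    · intro μ _ Z hZ hind hlaw α hα hα1 hα2 h₀ w₀
      exact hM.ae_tendsto_tdrc hcov hη hβ hCpd hK hP hfix hZ hind hlaw (fun t => (hα t).1.le)
        hα1 hα2 h₀ w₀
  · have hHnot : ¬ PosDefForm M.H := fun h => hA (OffPolicyProblem.posDefForm_H_iff.1 h)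
    refine ⟨realSpectrum_inv_mul_mul_transpose hH hHs,
      realSpectrum_inv_mul_of_posDefForm hCpd M.transpose_C hHs,
      neg_pos.2 (lambdaMin_inv_mul_neg hCpd M.transpose_C hH hHs hHnot),
      fun hAu => neg_pos.2 (lambdaMaxNeg_inv_mul_neg (posDefForm_mul_transpose hAu) (by simp)
        hH hHs hHnot), fun hneg => ?_⟩
    have hAu : IsUnit M.Amat := by simpa using hneg.isUnit.neg
    refine neg_pos.2 (lambdaMax_inv_mul_neg (posDefForm_mul_transpose hAu) (by simp)
      hH hHs hHnot fun v hv => ?_)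
    have := hneg v hv
    rw [Matrix.neg_mulVec, dotProduct_neg] at this ⊢
    rwa [OffPolicyProblem.H, dotProduct_half_add_transpose_mulVec]
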